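/- A grading of a unital real associative algebra $\mathcal D$ by an abelian group $G$ is a decomposition $\mathcal D=\bigoplus_{g\in G}\mathcal D_g$ into subspaces with $\mathcal D_g\mathcal D_h\subseteq\mathcal D_{gh}$; its support is $\{g\in G:\mathcal D_g\neq0\}$. It is a division grading if every nonzero homogeneous element is invertible. A $G$-graded algebra $\mathcal D$ and an $H$-graded algebra $\mathcal E$ are equivalent if there is an algebra isomorphism $\psi:\mathcal D\to\mathcal E$ such that for every $g$ in the support of $\mathcal D$ there is $h\in H$ with $\psi(\mathcal D_g)=\mathcal E_h$. The tensor product (over $\mathbb R$) of a $G$-graded and an $H$-graded algebra is graded by $G\times H$ with components $\mathcal D_g\otimes\mathcal E_h$. Consider the following gradings of real algebras. - $M_2(\mathbb R)$, graded by $\mathbb Z_2^2=\langle a,b\rangle$: $\mathcal D_{a^sb^t}=\mathbb R\,X_a^sX_b^t$ ($0\le s,t\le1$), where $X_a=\begin{pmatrix}-1&0\\0&1\end{pmatrix}$ and $X_b=\begin{pmatrix}0&1\\1&0\end{pmatrix}$. - $\mathbb H$, graded by $\mathbb Z_2^2=\langle a,b\rangle$: $\mathbb H=\mathbb R1\oplus\mathbb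 Ri\oplus\mathbb Rj\oplus\mathbb Rk$, with degrees $e,a,b,ab$. - $\mathbb C$, graded by $\mathbb Z_2=\langle a\rangle$: $\mathbb C=\mathbb R1\oplus\mathbb Ri$, with degrees $e,a$. - $M_2(\mathbb C)$, graded by $\mathbb Z_2\times\mathbb Z_4=\langle a\rangle\times\langle b\rangle$: $\mathcal D_{a^sb^t}=\mathbb R\,X_a^sX_b^t$ ($0\le s\le1$, $0\le t\le3$), where $X_a=\begin{pmatrix}0&1\\1&0\end{pmatrix}$ and $X_b=\begin{pmatrix}1+i&0\\0&-1-i\end{pmatrix}$. Theorem. Each of the following graded tensor products, where $k\ge0$ is an integer and the factors are graded as above, is a division grading whose homogeneous components are all $1$-dimensional, its underlying real algebra is the indicated matrix algebra up to isomorphism, and its support is the whole grading group, which is isomorphic to the indicated group: - (1-a) $M_2(\mathbb R)^{\otimes k}\cong M_{2^k}(\mathbb R)$, with group $(\mathbb Z_2^2)^k\cong\mathbb Z_2^{2k}$; - (1-b) $M_2(\mathbb R)^{\otimes k}\otimes\mathbb H\cong M_{2^k}(\mathbb H)$, with group $(\mathbb Z_2^2)^{k}\times\mathbb Z_2^2\cong\mathbb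 Z_2^{2k+2}$; - (1-c) $M_2(\mathbb R)^{\otimes k}\otimes\mathbb C\cong M_{2^k}(\mathbb C)$, with group $(\mathbb Z_2^2)^k\times\mathbb Z_2\cong\mathbb Z_2^{2k+1}$; - (1-d) $M_2(\mathbb R)^{\otimes k}\otimes M_2(\mathbb C)\cong M_{2^{k+1}}(\mathbb C)$, with group $(\mathbb Z_2^2)^k\times(\mathbb Z_2\times\mathbb Z_4)\cong\mathbb Z_2^{2k+1}\times\mathbb Z_4$. Every division grading by an abelian group on a finite-dimensional simple real associative algebra whose nonzero homogeneous components are $1$-dimensional is equivalent to one, and only one, of these graded tensor products (exactly one of the four families and exactly one value of $k$). -/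

import Mathlib

open scoped TensorProduct Quaternion

namespace DivGrading

section General

variable {G H D E : Type*}

/-- A grading of the real algebra `D` by the abelian group `G` (written additively): `D` is the
internal direct sum of the subspaces `𝒜 g`, and `𝒜 g * 𝒜 h ⊆ 𝒜 (g + h)`. -/
structure IsGrading [AddCommGroup G] [DecidableEq G] [Ring D] [Algebra ℝ D]
    (𝒜 : G → Submodule ℝ D) : Prop where
  isInternal : DirectSum.IsInternal 𝒜
  gradedMul : SetLike.GradedMul 𝒜

/-- A division grading: every nonzero homogeneous element is invertible. -/
structure IsDivisionGrading [AddCommGroup G] [DecidableEq G] [Ring D] [Algebra ℝ D]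
    (𝒜 : G → Submodule ℝ D) : Prop extends IsGrading 𝒜 where
  isUnit_of_mem : ∀ (g : G) (x : D), x ∈ 𝒜 g → x ≠ 0 → IsUnit x

/-- The support: the degrees whose homogeneous component is nonzero. -/
def support [Ring D] [Algebra ℝ D] (𝒜 : G → Submodule ℝ D) : Set G :=
  {g | 𝒜 g ≠ ⊥}

/-- The (nonzero) homogeneous components have real dimension one. -/
def HasDimOneComponents [Ring D] [Algebra ℝ D] (𝒜 : G → Submodule ℝ D) : Prop :=
  ∀ g ∈ support 𝒜, Module.finrank ℝ (𝒜 g) = 1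

/-- Equivalence of graded algebras: an isomorphism of algebras that maps every nonzero
homogeneous component onto a homogeneous component. The grading groups may differ. -/
def GradedEquivalent [Ring D] [Algebra ℝ D] [Ring E] [Algebra ℝ E]
    (𝒜 : G → Submodule ℝ D) (ℬ : H → Submodule ℝ E) : Prop :=
  ∃ ψ : D ≃ₐ[ℝ] E, ∀ g ∈ support 𝒜, ∃ h : H, (𝒜 g).map ψ.toLinearMap = ℬ h

/-- The tensor product of two real algebras, with the componentwise product. -/
abbrev TensorAlg (D E : Type*) [Ring D] [Algebra ℝ D] [Ring E] [Algebra ℝ E] : Type _ := D ⊗[ℝ] E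

/-- The `k`-fold tensor power of a real algebra, with the componentwise product. -/
abbrev PowAlg (D : Type*) [Ring D] [Algebra ℝ D] (k : ℕ) : Type _ := ⨂[ℝ] _ : Fin k, D

/-- The grading of `D ⊗ E` by `G × H` with components `𝒜 g ⊗ ℬ h`. -/
def tensorGrading [Ring D] [Algebra ℝ D] [Ring E] [Algebra ℝ E]
    (𝒜 : G → Submodule ℝ D) (ℬ : H → Submodule ℝ E) : G × H → Submodule ℝ (TensorAlg D E) :=
  fun p => Submodule.map₂ (TensorProduct.mk ℝ D E) (𝒜 p.1) (ℬ p.2)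

/-- The grading of the `k`-fold tensor power of `D` by `G ^ k`: the component of degree
`(g₁, …, g_k)` is `𝒜 g₁ ⊗ ⋯ ⊗ 𝒜 g_k`, the span of the tensors `x₁ ⊗ ⋯ ⊗ x_k` with
`x_i ∈ 𝒜 g_i`. -/
def powGrading [Ring D] [Algebra ℝ D] (𝒜 : G → Submodule ℝ D) (k : ℕ) :
    (Fin k → G) → Submodule ℝ (PowAlg D k) :=
  fun g => Submodule.span ℝ
    {t | ∃ x : Fin k → D, (∀ i, x i ∈ 𝒜 (g i)) ∧ PiTensorProduct.tprod ℝ x = t}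

end General

/-- The algebra `M_2(ℝ)`. -/
abbrev M2R : Type := Matrix (Fin 2) (Fin 2) ℝ

/-- The algebra `M_2(ℂ)`, regarded as a real algebra. -/
abbrev M2C : Type := Matrix (Fin 2) (Fin 2) ℂ

/-- The grading of `M_2(ℝ)` by `ℤ₂ × ℤ₂`: with `X_a = diag(-1, 1)` of degree `(1, 0)` and
`X_b = (0 1; 1 0)` of degree `(0, 1)`, the components are
`ℝ 1`, `ℝ X_a`, `ℝ X_b` and `ℝ X_a X_b = ℝ (0 -1; 1 0)`. -/
noncomputable def gradingM2R (g : ZMod 2 × ZMod 2) : Submodule ℝ M2R :=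
  Submodule.span ℝ {(!![-1, 0; 0, 1] : M2R) ^ g.1.val * (!![0, 1; 1, 0] : M2R) ^ g.2.val}

/-- The grading of `ℍ` by `ℤ₂ × ℤ₂` with components `ℝ 1`, `ℝ i`, `ℝ j` and `ℝ k = ℝ ij`, of
degrees `(0, 0)`, `(1, 0)`, `(0, 1)` and `(1, 1)`. -/
noncomputable def gradingQuaternion (g : ZMod 2 × ZMod 2) : Submodule ℝ ℍ[ℝ] :=
  Submodule.span ℝ {(⟨0, 1, 0, 0⟩ : ℍ[ℝ]) ^ g.1.val * (⟨0, 0, 1, 0⟩ : ℍ[ℝ]) ^ g.2.val}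

/-- The grading of `ℂ` by `ℤ₂` with components `ℝ 1` and `ℝ i`. -/
noncomputable def gradingComplex (g : ZMod 2) : Submodule ℝ ℂ :=
  Submodule.span ℝ {Complex.I ^ g.val}

/-- The grading of the real algebra `M_2(ℂ)` by `ℤ₂ × ℤ₄`: with `X_a = (0 1; 1 0)` of degree
`(1, 0)` and `X_b = diag(1 + i, -1 - i)` of degree `(0, 1)`, the component of degree `(s, t)` is
`ℝ X_a ^ s X_b ^ t`. Here `X_b ^ 2 = 2 diag(i, i)` and `X_b ^ 3 = 2 diag(-1 + i, 1 - i)`. -/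
noncomputable def gradingM2C (g : ZMod 2 × ZMod 4) : Submodule ℝ M2C :=
  Submodule.span ℝ {(!![0, 1; 1, 0] : M2C) ^ g.1.val *
    (!![1 + Complex.I, 0; 0, -1 - Complex.I] : M2C) ^ g.2.val}

/-- `M_2(ℝ)^{⊗k}`. -/
abbrev AlgA (k : ℕ) : Type := PowAlg M2R k

/-- `M_2(ℝ)^{⊗k} ⊗ ℍ`. -/
abbrev AlgB (k : ℕ) : Type := TensorAlg (AlgA k) ℍ[ℝ]

/-- `M_2(ℝ)^{⊗k} ⊗ ℂ`. -/
abbrev AlgC (k : ℕ) : Type := TensorAlg (AlgA k) ℂ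

/-- `M_2(ℝ)^{⊗k} ⊗ M_2(ℂ)`. -/
abbrev AlgD (k : ℕ) : Type := TensorAlg (AlgA k) M2C

/-- The group `(ℤ₂²)^k`. -/
abbrev GrpA (k : ℕ) : Type := Fin k → ZMod 2 × ZMod 2

/-- The group `(ℤ₂²)^k × ℤ₂²`. -/
abbrev GrpB (k : ℕ) : Type := GrpA k × (ZMod 2 × ZMod 2)

/-- The group `(ℤ₂²)^k × ℤ₂`. -/
abbrev GrpC (k : ℕ) : Type := GrpA k × ZMod 2

/-- The group `(ℤ₂²)^k × (ℤ₂ × ℤ₄)`. -/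
abbrev GrpD (k : ℕ) : Type := GrpA k × (ZMod 2 × ZMod 4)

/-- The graded tensor product `M_2(ℝ)^{⊗k}`. -/
noncomputable def gradingA (k : ℕ) : GrpA k → Submodule ℝ (AlgA k) :=
  powGrading gradingM2R k

/-- The graded tensor product `M_2(ℝ)^{⊗k} ⊗ ℍ`. -/
noncomputable def gradingB (k : ℕ) : GrpB k → Submodule ℝ (AlgB k) :=
  tensorGrading (gradingA k) gradingQuaternion

/-- The graded tensor product `M_2(ℝ)^{⊗k} ⊗ ℂ`. -/
noncomputable def gradingC (k : ℕ) : GrpC k → Submodule ℝ (AlgC k) :=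
  tensorGrading (gradingA k) gradingComplex

/-- The graded tensor product `M_2(ℝ)^{⊗k} ⊗ M_2(ℂ)`. -/
noncomputable def gradingD (k : ℕ) : GrpD k → Submodule ℝ (AlgD k) :=
  tensorGrading (gradingA k) gradingM2C

/-- The entries of the list: four families, each indexed by the number `k ≥ 0` of tensor factors
`M_2(ℝ)` that precede the last, distinguished factor (if there is one). -/
inductive ListEntry : Type
  | a (k : ℕ) : ListEntry
  | b (k : ℕ) : ListEntry
  | c (k : ℕ) : ListEntry
  | d (k : ℕ) : ListEntry

/-- The graded algebra `(D, 𝒜)` is equivalent to the given entry of the list. -/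
def IsEquivalentToEntry {G D : Type*} [Ring D] [Algebra ℝ D] (𝒜 : G → Submodule ℝ D) :
    ListEntry → Prop
  | .a k => GradedEquivalent 𝒜 (gradingA k)
  | .b k => GradedEquivalent 𝒜 (gradingB k)
  | .c k => GradedEquivalent 𝒜 (gradingC k)
  | .d k => GradedEquivalent 𝒜 (gradingD k)

end DivGrading

/-!
A division grading with one-dimensional components is determined up to equivalence by the
multiplication of its homogeneous elements. Two nonzero homogeneous elements commute up to a real
factor, and since the degrees in the support have finite order this factor is `±1`
(`IsDivisionGrading.isSignCommutative`). Hence the squares of homogeneous elements are central. The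
centre of a finite-dimensional simple real algebra is `ℝ` or `ℂ`; so the central homogeneous
elements are either real, or real multiples of `1` and of some `f` with `f ^ 2 = -1`
(`IsDivisionGrading.central_homogeneous`).

The classification works in the multiplicative set of nonzero homogeneous elements. A hyperbolic
pair, i.e. two anticommuting elements with square `1`, generates a graded copy of `M_2(ℝ)`, and
every homogeneous element is a product of an element of this copy and one that commutes with the
pair. Splitting off such pairs as long as possible gives a homomorphism from `M_2(ℝ)^{⊗k}` and a
set `T` of homogeneous elements without hyperbolic pairs that commute with its range, and the two
together generate the algebra (`exists_algHom_algA`). If the centre is real, `T` is scalar or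
generates `ℍ` (`IsSignCommutative.scalar_or_quaternion`); this contains the isomorphism
`ℍ ⊗ ℍ ≅ M_2(ℝ) ⊗ M_2(ℝ)` in the form that two commuting quaternion pairs yield a hyperbolic pair.
If the centre is `ℂ`, `T` generates `ℂ` or, when some square is not real, `M_2(ℂ)`
(`IsSignCommutative.central_or_quartic`). The resulting homomorphism from an algebra of the list is
injective because that algebra is simple, and surjective because its range contains all homogeneous
elements (`gradedEquivalent_of_algHom`).

Uniqueness follows from dimensions, except for two coincidences: `M_{2n}(ℝ)` and `M_n(ℍ)` differ in
the dimensions of their right ideals, and in the family with last factor `ℂ`, unlike the one with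
last factor `M_2(ℂ)`, all squares of homogeneous elements are real.

That the graded algebras of the list have the stated properties reduces to their bases of monomials
in anticommuting elements (`IsGradedBasis`, `IsAntiPair`), as such bases pass to tensor products.
-/

namespace DivGrading

/-! ### Graded bases -/

section GradedBasis

variable {G H D E : Type*} [AddCommGroup G] [AddCommGroup H] [Ring D] [Algebra ℝ D]
  [Ring E] [Algebra ℝ E]

/-- A basis of `D` indexed by the group `G`, with `X 0 = 1`, that is multiplicative up to nonzero
real factors. The lines `ℝ (X g)` then form a division grading with support `G`. -/
structure IsGradedBasis (X : G → D) : Prop where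
  linearIndependent : LinearIndependent ℝ X
  span_eq_top : Submodule.span ℝ (Set.range X) = ⊤
  apply_zero : X 0 = 1
  mul_apply : ∀ g h, ∃ c : ℝ, c ≠ 0 ∧ X g * X h = c • X (g + h)

namespace IsGradedBasis

variable {X : G → D} {Y : H → E}

/-- The basis of `D` underlying a graded basis. -/
noncomputable def basis (hX : IsGradedBasis X) : Module.Basis G ℝ D :=
  Module.Basis.mk hX.linearIndependent hX.span_eq_top.ge

@[simp] lemma basis_apply (hX : IsGradedBasis X) (g : G) : hX.basis g = X g := by
  simp [basis]

lemma ne_zero (hX : IsGradedBasis X) (g : G) : X g ≠ 0 := hX.linearIndependent.ne_zero g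

lemma eq_of_smul_eq_smul (hX : IsGradedBasis X) {g h : G} {a b : ℝ} (hb : b ≠ 0)
    (e : a • X g = b • X h) : g = h := by
  have := congrArg hX.basis.repr e
  rw [← hX.basis_apply, ← hX.basis_apply, map_smul, map_smul, Module.Basis.repr_self,
    Module.Basis.repr_self, Finsupp.smul_single_one, Finsupp.smul_single_one,
    Finsupp.single_eq_single_iff] at this
  exact this.elim And.left fun h => (hb h.2).elim

lemma isUnit (hX : IsGradedBasis X) (g : G) : IsUnit (X g) := by
  obtain ⟨c, hc, h⟩ := hX.mul_apply g (-g)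
  obtain ⟨d, hd, h'⟩ := hX.mul_apply (-g) g
  rw [add_neg_cancel, hX.apply_zero] at h
  rw [neg_add_cancel, hX.apply_zero] at h'
  rw [isUnit_iff_exists_and_exists]
  exact ⟨⟨c⁻¹ • X (-g), by rw [mul_smul_comm, h, inv_smul_smul₀ hc]⟩,
    ⟨d⁻¹ • X (-g), by rw [smul_mul_assoc, h', inv_smul_smul₀ hd]⟩⟩

lemma isDivisionGrading [DecidableEq G] (hX : IsGradedBasis X) :
    IsDivisionGrading fun g => Submodule.span ℝ {X g} where
  isInternal := by
    refine (DirectSum.isInternal_submodule_iff_iSupIndep_and_iSup_eq_top _).2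
      ⟨hX.linearIndependent.iSupIndep_span_singleton, ?_⟩
    rw [← Submodule.span_range_eq_iSup, hX.span_eq_top]
  gradedMul := ⟨by
    intro g h x y hx hy
    obtain ⟨a, rfl⟩ := Submodule.mem_span_singleton.1 hx
    obtain ⟨b, rfl⟩ := Submodule.mem_span_singleton.1 hy
    obtain ⟨c, -, h⟩ := hX.mul_apply g h
    rw [smul_mul_smul_comm, h]
    exact Submodule.smul_mem _ _ (Submodule.smul_mem _ _ (Submodule.mem_span_singleton_self _))⟩
  isUnit_of_mem := by
    intro g x hx hx0
    obtain ⟨a, rfl⟩ := Submodule.mem_span_singleton.1 hx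
    have ha : a ≠ 0 := by rintro rfl; simp at hx0
    exact (hX.isUnit g).smul (Units.mk0 a ha)

lemma support_eq_univ (hX : IsGradedBasis X) :
    support (fun g => Submodule.span ℝ {X g}) = Set.univ := by
  ext g
  simpa [support] using hX.ne_zero g

lemma hasDimOneComponents (hX : IsGradedBasis X) :
    HasDimOneComponents fun g => Submodule.span ℝ {X g} :=
  fun g _ => finrank_span_singleton (hX.ne_zero g)

lemma tensor (hX : IsGradedBasis X) (hY : IsGradedBasis Y) :
    IsGradedBasis (D := TensorAlg D E) fun p : G × H => X p.1 ⊗ₜ[ℝ] Y p.2 := by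
  have hb : (fun p : G × H => X p.1 ⊗ₜ[ℝ] Y p.2) = hX.basis.tensorProduct hY.basis := by
    ext p
    simp [Module.Basis.tensorProduct_apply']
  refine ⟨?_, ?_, ?_, ?_⟩
  · rw [hb]; exact Module.Basis.linearIndependent _
  · rw [hb]; exact Module.Basis.span_eq _
  · simp [hX.apply_zero, hY.apply_zero, Algebra.TensorProduct.one_def]
  · rintro ⟨g, h⟩ ⟨g', h'⟩
    obtain ⟨c, hc, e⟩ := hX.mul_apply g g'
    obtain ⟨d, hd, e'⟩ := hY.mul_apply h h'
    refine ⟨c * d, mul_ne_zero hc hd, ?_⟩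
    simp only [Algebra.TensorProduct.tmul_mul_tmul, e, e', TensorProduct.smul_tmul_smul,
      Prod.mk_add_mk]

lemma pow (hX : IsGradedBasis X) (k : ℕ) :
    IsGradedBasis (D := PowAlg D k)
      fun g : Fin k → G => PiTensorProduct.tprod ℝ fun i => X (g i) := by
  have hb : (fun g : Fin k → G => PiTensorProduct.tprod ℝ fun i => X (g i)) =
      Basis.piTensorProduct (fun _ : Fin k => hX.basis) := by
    ext p
    simp [Basis.piTensorProduct_apply]
  refine ⟨?_, ?_, ?_, ?_⟩
  · rw [hb]; exact Module.Basis.linearIndependent _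
  · rw [hb]; exact Module.Basis.span_eq _
  · simp only [Pi.zero_apply, hX.apply_zero]; rfl
  · intro g h
    choose c hc e using fun i => hX.mul_apply (g i) (h i)
    refine ⟨∏ i, c i, Finset.prod_ne_zero_iff.2 fun i _ => hc i, ?_⟩
    rw [PiTensorProduct.tprod_mul_tprod, ← MultilinearMap.map_smul_univ]
    congr 1
    ext i
    exact e i

end IsGradedBasis

end GradedBasis

section SpanSingleton

variable {G H D E : Type*} [Ring D] [Algebra ℝ D] [Ring E] [Algebra ℝ E]

lemma tensorGrading_span_singleton (X : G → D) (Y : H → E) :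
    tensorGrading (fun g => Submodule.span ℝ {X g}) (fun h => Submodule.span ℝ {Y h}) =
      fun p => Submodule.span ℝ {X p.1 ⊗ₜ[ℝ] Y p.2} := by
  ext1 p
  simp [tensorGrading, Submodule.map₂_span_span]

lemma powGrading_span_singleton (X : G → D) (k : ℕ) :
    powGrading (fun g => Submodule.span ℝ {X g}) k =
      fun g => Submodule.span ℝ {PiTensorProduct.tprod ℝ fun i => X (g i)} := by
  ext1 g
  refine le_antisymm (Submodule.span_le.2 ?_) (Submodule.span_mono ?_)
  · rintro _ ⟨x, hx, rfl⟩
    choose c hc using fun i => Submodule.mem_span_singleton.1 (hx i)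
    obtain rfl : (fun i => c i • X (g i)) = x := funext hc
    rw [MultilinearMap.map_smul_univ]
    exact Submodule.smul_mem _ _ (Submodule.mem_span_singleton_self _)
  · rintro _ rfl
    exact ⟨_, fun i => Submodule.mem_span_singleton_self _, rfl⟩

end SpanSingleton

/-! ### Equivalence of gradings -/

section Equivalence

variable {G H K D E F : Type*} [Ring D] [Algebra ℝ D] [Ring E] [Algebra ℝ E] [Ring F] [Algebra ℝ F]
  {𝒜 : G → Submodule ℝ D} {ℬ : H → Submodule ℝ E} {𝒞 : K → Submodule ℝ F}

lemma GradedEquivalent.trans (h₁ : GradedEquivalent 𝒜 ℬ) (h₂ : GradedEquivalent ℬ 𝒞) :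
    GradedEquivalent 𝒜 𝒞 := by
  obtain ⟨ψ, hψ⟩ := h₁
  obtain ⟨χ, hχ⟩ := h₂
  refine ⟨ψ.trans χ, fun g hg => ?_⟩
  obtain ⟨h, hh⟩ := hψ g hg
  have hs : h ∈ support ℬ := by
    intro h0
    rw [h0] at hh
    exact hg ((Submodule.map_eq_bot_iff (e := ψ.toLinearEquiv)).1 hh)
  obtain ⟨l, hl⟩ := hχ h hs
  refine ⟨l, ?_⟩
  rw [← hl, ← hh, ← Submodule.map_comp]
  rfl

/-- The components of `ℬ` that are images of components of `𝒜` already span, so by independence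
no component of `ℬ` is missed. -/
lemma GradedEquivalent.symm [AddCommGroup G] [DecidableEq G] [AddCommGroup H] [DecidableEq H]
    (hA : IsGrading 𝒜) (hB : IsGrading ℬ) (h : GradedEquivalent 𝒜 ℬ) : GradedEquivalent ℬ 𝒜 := by
  obtain ⟨ψ, hψ⟩ := h
  refine ⟨ψ.symm, fun h hh => ?_⟩
  obtain ⟨g, hg⟩ : ∃ g, (𝒜 g).map ψ.toLinearMap = ℬ h := by
    by_contra! hne
    have hle : ∀ g, (𝒜 g).map ψ.toLinearMap ≤ ⨆ (j) (_ : j ≠ h), ℬ j := by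
      intro g
      by_cases hg : g ∈ support 𝒜
      · obtain ⟨j, hj⟩ := hψ g hg
        rw [hj]
        exact le_iSup₂_of_le j (fun e => hne g (e ▸ hj)) le_rfl
      · rw [support, Set.mem_ofPred_eq, not_not] at hg
        simp [hg]
    have htop : (⊤ : Submodule ℝ E) ≤ ⨆ (j) (_ : j ≠ h), ℬ j := by
      calc (⊤ : Submodule ℝ E) = (⊤ : Submodule ℝ D).map ψ.toLinearMap := by
            rw [Submodule.map_top, LinearMap.range_eq_top.2 ψ.surjective]
        _ = ⨆ g, (𝒜 g).map ψ.toLinearMap := by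
            rw [← hA.isInternal.submodule_iSup_eq_top, Submodule.map_iSup]
        _ ≤ _ := iSup_le hle
    exact hh ((hB.isInternal.submodule_iSupIndep h).eq_bot_of_le (le_top.trans htop))
  refine ⟨g, ?_⟩
  rw [← hg, ← Submodule.map_comp]
  convert Submodule.map_id _
  ext x
  simp

end Equivalence

/-! ### Monomials in two anticommuting elements -/

section PairFamily

variable {D E : Type*} [Ring D] [Algebra ℝ D] [Ring E] [Algebra ℝ E] {m n : ℕ} {p q : ℝ}

/-- Two anticommuting elements with `x ^ m = p` and `y ^ n = q`. -/
structure IsAntiPair (m n : ℕ) (p q : ℝ) (x y : D) : Prop where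
  pow_left : x ^ m = p • (1 : D)
  pow_right : y ^ n = q • (1 : D)
  anti : y * x = -(x * y)

/-- The monomials `x ^ s * y ^ t`, indexed by the exponents modulo `m` and `n`. -/
def monomials (m n : ℕ) (x y : D) (g : ZMod m × ZMod n) : D := x ^ g.1.val * y ^ g.2.val

/-- The structure constants of the monomials in two anticommuting elements `x`, `y` with
`x ^ m = p` and `y ^ n = q`. -/
def monomialCoeff (m n : ℕ) (p q : ℝ) (g h : ZMod m × ZMod n) : ℝ :=
  (-1) ^ (g.2.val * h.1.val) * (p ^ ((g.1.val + h.1.val) / m) * q ^ ((g.2.val + h.2.val) / n))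

lemma monomialCoeff_ne_zero (hp : p ≠ 0) (hq : q ≠ 0) (g h : ZMod m × ZMod n) :
    monomialCoeff m n p q g h ≠ 0 := by
  unfold monomialCoeff
  positivity

lemma pow_eq_smul_pow_mod {x : D} (hx : x ^ m = p • (1 : D)) (a : ℕ) :
    x ^ a = p ^ (a / m) • x ^ (a % m) := by
  conv_lhs => rw [← Nat.div_add_mod a m]
  rw [pow_add, pow_mul, hx, smul_pow, one_pow, smul_mul_assoc, one_mul]

lemma pow_mul_pow_of_anti {x y : D} (h : y * x = -(x * y)) (s t : ℕ) :
    y ^ t * x ^ s = ((-1 : ℝ) ^ (t * s)) • (x ^ s * y ^ t) := by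
  have h1 : ∀ s : ℕ, y * x ^ s = ((-1 : ℝ) ^ s) • (x ^ s * y) := by
    intro s
    induction s with
    | zero => simp
    | succ s ih =>
      rw [pow_succ x, ← mul_assoc, ih, smul_mul_assoc, mul_assoc, h, mul_neg, ← mul_assoc,
        pow_succ (-1 : ℝ), mul_neg_one, neg_smul, smul_neg]
  induction t with
  | zero => simp
  | succ t ih =>
    rw [pow_succ y, mul_assoc, h1, mul_smul_comm, ← mul_assoc, ih, smul_mul_assoc, smul_smul,
      ← pow_add, mul_assoc]
    congr 2
    ring

lemma monomials_zero {R : Type*} [Ring R] (x y : R) : monomials m n x y 0 = 1 := by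
  simp [monomials]

namespace IsAntiPair

variable {x y : D} {x' y' : E}

lemma monomials_mul [NeZero m] [NeZero n] (h : IsAntiPair m n p q x y) (g g' : ZMod m × ZMod n) :
    monomials m n x y g * monomials m n x y g' =
      monomialCoeff m n p q g g' • monomials m n x y (g + g') := by
  unfold monomials monomialCoeff
  rw [mul_assoc, ← mul_assoc (y ^ _), pow_mul_pow_of_anti h.anti, smul_mul_assoc, mul_smul_comm,
    mul_smul, mul_assoc, ← pow_add, ← mul_assoc, ← pow_add, pow_eq_smul_pow_mod h.pow_left,
    pow_eq_smul_pow_mod h.pow_right, smul_mul_smul_comm, Prod.fst_add, Prod.snd_add, ZMod.val_add,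
    ZMod.val_add]

lemma isGradedBasis [NeZero m] [NeZero n] [FiniteDimensional ℝ D] (h : IsAntiPair m n p q x y)
    (hp : p ≠ 0) (hq : q ≠ 0) (hli : LinearIndependent ℝ (monomials m n x y))
    (hdim : Module.finrank ℝ D = m * n) : IsGradedBasis (monomials m n x y) where
  linearIndependent := hli
  span_eq_top := hli.span_eq_top_of_card_eq_finrank' (by simp [hdim, ZMod.card])
  apply_zero := monomials_zero x y
  mul_apply g g' := ⟨_, monomialCoeff_ne_zero hp hq g g', h.monomials_mul g g'⟩

/-- Two anticommuting pairs with the same powers have the same structure constants, so if the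
monomials of the first one form a basis there is a homomorphism that maps it to the second one. -/
lemma exists_algHom [NeZero m] [NeZero n] (h : IsAntiPair m n p q x y)
    (hb : IsGradedBasis (monomials m n x y)) (h' : IsAntiPair m n p q x' y') :
    ∃ f : D →ₐ[ℝ] E, ∀ g, f (monomials m n x y g) = monomials m n x' y' g := by
  set F : D →ₗ[ℝ] E := hb.basis.constr ℝ (monomials m n x' y') with hF
  have hFX : ∀ g, F (monomials m n x y g) = monomials m n x' y' g := by
    intro g
    rw [hF, ← hb.basis_apply g, Module.Basis.constr_basis]
  refine ⟨AlgHom.ofLinearMap F ?_ ?_, hFX⟩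
  · rw [← monomials_zero (m := m) (n := n) x y, hFX, monomials_zero]
  · have : (LinearMap.mul ℝ D).compr₂ F = (LinearMap.mul ℝ E).compl₁₂ F F := by
      refine hb.basis.ext fun g => hb.basis.ext fun g' => ?_
      simp [h.monomials_mul, h'.monomials_mul, hFX]
    intro a b
    simpa using LinearMap.congr_fun₂ this a b

end IsAntiPair

end PairFamily

/-! ### The four tensor factors -/

section Factors

lemma isAntiPair_M2R :
    IsAntiPair 2 2 1 1 (!![-1, 0; 0, 1] : M2R) (!![0, 1; 1, 0] : M2R) where
  pow_left := by ext i j; fin_cases i <;> fin_cases j <;> simp [pow_two]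
  pow_right := by ext i j; fin_cases i <;> fin_cases j <;> simp [pow_two]
  anti := by ext i j; fin_cases i <;> fin_cases j <;> simp

lemma isAntiPair_quaternion :
    IsAntiPair 2 2 (-1) (-1) (⟨0, 1, 0, 0⟩ : ℍ[ℝ]) (⟨0, 0, 1, 0⟩ : ℍ[ℝ]) where
  pow_left := by ext <;> simp [pow_two]
  pow_right := by ext <;> simp [pow_two]
  anti := by ext <;> simp

lemma isAntiPair_M2C :
    IsAntiPair 2 4 1 (-4) (!![0, 1; 1, 0] : M2C)
      (!![1 + Complex.I, 0; 0, -1 - Complex.I] : M2C) where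
  pow_left := by ext i j; fin_cases i <;> fin_cases j <;> simp [pow_two]
  pow_right := by
    ext i j
    fin_cases i <;> fin_cases j <;> apply Complex.ext <;> simp [pow_succ] <;> norm_num
  anti := by ext i j; fin_cases i <;> fin_cases j <;> simp <;> ring

lemma sum_zmod_two {M : Type*} [AddCommMonoid M] (f : ZMod 2 → M) : ∑ i, f i = f 0 + f 1 :=
  Fin.sum_univ_two f

lemma sum_zmod_four {M : Type*} [AddCommMonoid M] (f : ZMod 4 → M) :
    ∑ i, f i = f 0 + f 1 + f 2 + f 3 :=
  Fin.sum_univ_four f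

lemma forall_zmod_two {P : ZMod 2 → Prop} : (∀ i, P i) ↔ P 0 ∧ P 1 :=
  Fin.forall_fin_two

lemma forall_zmod_four {P : ZMod 4 → Prop} (h0 : P 0) (h1 : P 1) (h2 : P 2) (h3 : P 3) (i) :
    P i := by
  fin_cases i <;> assumption

lemma isGradedBasis_M2R :
    IsGradedBasis (monomials 2 2 (!![-1, 0; 0, 1] : M2R) (!![0, 1; 1, 0] : M2R)) := by
  refine isAntiPair_M2R.isGradedBasis one_ne_zero one_ne_zero ?_ (by simp [Module.finrank_matrix])
  rw [Fintype.linearIndependent_iff]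
  intro c hc
  simp only [Fintype.sum_prod_type, sum_zmod_two, monomials] at hc
  have e := fun i j => congrFun (congrFun hc i) j
  have e1 := e 0 0
  have e2 := e 0 1
  have e3 := e 1 0
  have e4 := e 1 1
  simp [ZMod.val_one] at e1 e2 e3 e4
  rw [Prod.forall, forall_zmod_two, forall_zmod_two, forall_zmod_two]
  refine ⟨⟨?_, ?_⟩, ?_, ?_⟩ <;> linarith

lemma isGradedBasis_quaternion :
    IsGradedBasis (monomials 2 2 (⟨0, 1, 0, 0⟩ : ℍ[ℝ]) (⟨0, 0, 1, 0⟩ : ℍ[ℝ])) := by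
  refine isAntiPair_quaternion.isGradedBasis (by norm_num) (by norm_num) ?_
    Quaternion.finrank_eq_four
  rw [Fintype.linearIndependent_iff]
  intro c hc
  simp only [Fintype.sum_prod_type, sum_zmod_two, monomials] at hc
  have e1 := congrArg QuaternionAlgebra.re hc
  have e2 := congrArg QuaternionAlgebra.imI hc
  have e3 := congrArg QuaternionAlgebra.imJ hc
  have e4 := congrArg QuaternionAlgebra.imK hc
  simp [ZMod.val_one] at e1 e2 e3 e4
  rw [Prod.forall, forall_zmod_two, forall_zmod_two, forall_zmod_two]
  exact ⟨⟨by assumption, by assumption⟩, by assumption, by assumption⟩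

lemma isGradedBasis_M2C :
    IsGradedBasis (monomials 2 4 (!![0, 1; 1, 0] : M2C)
      (!![1 + Complex.I, 0; 0, -1 - Complex.I] : M2C)) := by
  refine isAntiPair_M2C.isGradedBasis (by norm_num) (by norm_num) ?_
    (by simp [Module.finrank_matrix])
  rw [Fintype.linearIndependent_iff]
  intro c hc
  simp only [Fintype.sum_prod_type, sum_zmod_two, sum_zmod_four, monomials] at hc
  have e := fun i j => congrFun (congrFun hc i) j
  have v2 : (2 : ZMod 4).val = 2 := rfl
  have v3 : (3 : ZMod 4).val = 3 := rfl
  have v1 : (1 : ZMod 4).val = 1 := rfl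
  have e1 := congrArg Complex.re (e 0 0)
  have e2 := congrArg Complex.re (e 0 1)
  have e3 := congrArg Complex.re (e 1 0)
  have e4 := congrArg Complex.re (e 1 1)
  have e5 := congrArg Complex.im (e 0 0)
  have e6 := congrArg Complex.im (e 0 1)
  have e7 := congrArg Complex.im (e 1 0)
  have e8 := congrArg Complex.im (e 1 1)
  simp [ZMod.val_one, pow_succ, v1, v2, v3] at e1 e2 e3 e4 e5 e6 e7 e8
  rw [Prod.forall, forall_zmod_two]
  refine ⟨forall_zmod_four ?_ ?_ ?_ ?_, forall_zmod_four ?_ ?_ ?_ ?_⟩ <;> linarith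

lemma isGradedBasis_complex : IsGradedBasis fun g : ZMod 2 => Complex.I ^ g.val where
  linearIndependent := by
    rw [Fintype.linearIndependent_iff]
    intro c hc
    simp only [sum_zmod_two] at hc
    have e1 := congrArg Complex.re hc
    have e2 := congrArg Complex.im hc
    simp [ZMod.val_one] at e1 e2
    exact forall_zmod_two.2 ⟨e1, e2⟩
  span_eq_top := by
    rw [eq_top_iff]
    rintro z -
    have : z = z.re • (Complex.I ^ (0 : ZMod 2).val) + z.im • (Complex.I ^ (1 : ZMod 2).val) := by
      apply Complex.ext <;> simp [ZMod.val_one]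
    rw [this]
    exact Submodule.add_mem _ (Submodule.smul_mem _ _ (Submodule.subset_span ⟨0, rfl⟩))
      (Submodule.smul_mem _ _ (Submodule.subset_span ⟨1, rfl⟩))
  apply_zero := by simp
  mul_apply g h := by
    refine ⟨(-1) ^ ((g.val + h.val) / 2), by positivity, ?_⟩
    rw [← pow_add, pow_eq_smul_pow_mod (p := -1) (m := 2) (by simp), ZMod.val_add]

end Factors

/-! ### Splitting tensor powers -/

section Cons

variable {D κ : Type*} [Ring D] [Algebra ℝ D]

/-- The multilinear map `(x₀, …, x_k) ↦ x₀ ⊗ (x₁ ⊗ ⋯ ⊗ x_k)`. -/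
noncomputable def consMultilinear (D : Type*) [Ring D] [Algebra ℝ D] (k : ℕ) :
    MultilinearMap ℝ (fun _ : Fin (k + 1) => D) (TensorAlg D (PowAlg D k)) :=
  LinearMap.uncurryLeft
    { toFun := fun m => (TensorProduct.mk ℝ D (PowAlg D k) m).compMultilinearMap
        (PiTensorProduct.tprod ℝ)
      map_add' := fun m m' => by ext; simp
      map_smul' := fun c m => by ext; simp [TensorProduct.smul_tmul'] }

lemma consMultilinear_apply (k : ℕ) (x : Fin (k + 1) → D) :
    consMultilinear D k x = x 0 ⊗ₜ[ℝ] PiTensorProduct.tprod ℝ (fun i => x i.succ) := rfl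

/-- The homomorphism `x₀ ⊗ x₁ ⊗ ⋯ ⊗ x_k ↦ x₀ ⊗ (x₁ ⊗ ⋯ ⊗ x_k)`. -/
noncomputable def consAlgHom (D : Type*) [Ring D] [Algebra ℝ D] (k : ℕ) :
    PowAlg D (k + 1) →ₐ[ℝ] TensorAlg D (PowAlg D k) :=
  PiTensorProduct.liftAlgHom (consMultilinear D k) rfl (fun x y => by
    simp only [consMultilinear_apply, Algebra.TensorProduct.tmul_mul_tmul,
      PiTensorProduct.tprod_mul_tprod]
    rfl)

lemma consAlgHom_tprod (k : ℕ) (x : Fin (k + 1) → D) :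
    consAlgHom D k (PiTensorProduct.tprod ℝ x) =
      x 0 ⊗ₜ[ℝ] PiTensorProduct.tprod ℝ (fun i => x i.succ) :=
  PiTensorProduct.lift.tprod x

lemma consAlgHom_bijective [FiniteDimensional ℝ D] (k : ℕ) :
    Function.Bijective (consAlgHom D k) := by
  let b := Module.finBasis ℝ D
  let B : ∀ k, Module.Basis (Fin k → Fin (Module.finrank ℝ D)) ℝ (PowAlg D k) :=
    fun k => Basis.piTensorProduct fun _ : Fin k => b
  have hsurj : Function.Surjective (consAlgHom D k).toLinearMap := by
    rw [← LinearMap.range_eq_top, eq_top_iff, ← (b.tensorProduct (B k)).span_eq, Submodule.span_le]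
    rintro _ ⟨⟨i, j⟩, rfl⟩
    refine ⟨PiTensorProduct.tprod ℝ (Fin.cons (b i) fun l => b (j l)), ?_⟩
    refine (consAlgHom_tprod k _).trans ?_
    simp [B, Module.Basis.tensorProduct_apply, Basis.piTensorProduct_apply]
  have := Module.Finite.of_basis (B (k + 1))
  have := Module.Finite.of_basis (B k)
  refine ⟨(LinearMap.injective_iff_surjective_of_finrank_eq_finrank
    (f := (consAlgHom D k).toLinearMap) ?_).2 hsurj, hsurj⟩
  rw [Module.finrank_tensorProduct, Module.finrank_eq_card_basis (B (k + 1)),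
    Module.finrank_eq_card_basis (B k)]
  simp [pow_succ']

/-- The splitting `D^{⊗(k+1)} ≃ D ⊗ D^{⊗k}` of the first tensor factor. -/
noncomputable def consEquiv (D : Type*) [Ring D] [Algebra ℝ D] [FiniteDimensional ℝ D] (k : ℕ) :
    PowAlg D (k + 1) ≃ₐ[ℝ] TensorAlg D (PowAlg D k) :=
  AlgEquiv.ofBijective (consAlgHom D k) (consAlgHom_bijective k)

lemma consEquiv_tprod [FiniteDimensional ℝ D] (k : ℕ) (x : Fin (k + 1) → D) :
    consEquiv D k (PiTensorProduct.tprod ℝ x) =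
      x 0 ⊗ₜ[ℝ] PiTensorProduct.tprod ℝ (fun i => x i.succ) :=
  consAlgHom_tprod k x

/-- The empty tensor power is `ℝ`. -/
lemma nonempty_powAlg_zero_equiv (D : Type*) [Ring D] [Algebra ℝ D] :
    Nonempty (PowAlg D 0 ≃ₐ[ℝ] ℝ) := by
  refine ⟨(AlgEquiv.ofBijective (Algebra.ofId ℝ (PowAlg D 0)) ?_).symm⟩
  have h : ⇑(Algebra.ofId ℝ (PowAlg D 0)) = (PiTensorProduct.isEmptyEquiv (R := ℝ)
      (s := fun _ : Fin 0 => D) (Fin 0)).symm := by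
    ext r
    rw [Algebra.ofId_apply, Algebra.algebraMap_eq_smul_one, LinearEquiv.eq_symm_apply]
    simp [PiTensorProduct.one_def, PiTensorProduct.isEmptyEquiv_apply_tprod]
  rw [h]
  exact LinearEquiv.bijective _

end Cons

/-! ### The underlying matrix algebras -/

section MatrixAlgebras

lemma nonempty_tensor_matrix_equiv {A E ι κ R : Type*} [Ring A] [Algebra ℝ A] [Ring E]
    [Algebra ℝ E] [Ring R] [Algebra ℝ R] [Fintype ι] [DecidableEq ι] [Fintype κ] [DecidableEq κ]
    (e : A ≃ₐ[ℝ] Matrix ι ι ℝ) (f : E ≃ₐ[ℝ] Matrix κ κ R) (N : ℕ)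
    (hN : Fintype.card ι * Fintype.card κ = N) :
    Nonempty (TensorAlg A E ≃ₐ[ℝ] Matrix (Fin N) (Fin N) R) := by
  have hcard : Fintype.card (ι × κ) = Fintype.card (Fin N) := by simp [hN]
  exact ⟨(Algebra.TensorProduct.comm ℝ A E).trans <|
    (Algebra.TensorProduct.congr f e).trans <|
    (matrixEquivTensor ι ℝ (Matrix κ κ R)).symm.trans <|
    (Matrix.compAlgEquiv ι κ R ℝ).trans <|
    Matrix.reindexAlgEquiv ℝ R (Fintype.equivOfCardEq hcard)⟩

lemma nonempty_equiv_matrix_one (R : Type*) [Ring R] [Algebra ℝ R] :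
    Nonempty (R ≃ₐ[ℝ] Matrix (Fin 1) (Fin 1) R) := by
  refine ⟨AlgEquiv.ofBijective (Matrix.scalarAlgHom (Fin 1) ℝ)
    ⟨fun a b h => ?_, fun M => ⟨M 0 0, ?_⟩⟩⟩
  · simpa using congrFun (congrFun h 0) 0
  · ext i j
    fin_cases i
    fin_cases j
    simp

lemma nonempty_algA_equiv (k : ℕ) :
    Nonempty (AlgA k ≃ₐ[ℝ] Matrix (Fin (2 ^ k)) (Fin (2 ^ k)) ℝ) := by
  induction k with
  | zero =>
    obtain ⟨e⟩ := nonempty_powAlg_zero_equiv M2R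
    obtain ⟨f⟩ := nonempty_equiv_matrix_one ℝ
    exact ⟨e.trans f⟩
  | succ k ih =>
    obtain ⟨e⟩ := ih
    obtain ⟨f⟩ := nonempty_tensor_matrix_equiv (AlgEquiv.refl : M2R ≃ₐ[ℝ] M2R) e (2 ^ (k + 1))
      (by simp [pow_succ'])
    exact ⟨(consEquiv M2R k).trans f⟩

lemma nonempty_algB_equiv (k : ℕ) :
    Nonempty (AlgB k ≃ₐ[ℝ] Matrix (Fin (2 ^ k)) (Fin (2 ^ k)) ℍ[ℝ]) := by
  obtain ⟨e⟩ := nonempty_algA_equiv k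
  obtain ⟨f⟩ := nonempty_equiv_matrix_one ℍ[ℝ]
  exact nonempty_tensor_matrix_equiv e f _ (by simp)

lemma nonempty_algC_equiv (k : ℕ) :
    Nonempty (AlgC k ≃ₐ[ℝ] Matrix (Fin (2 ^ k)) (Fin (2 ^ k)) ℂ) := by
  obtain ⟨e⟩ := nonempty_algA_equiv k
  obtain ⟨f⟩ := nonempty_equiv_matrix_one ℂ
  exact nonempty_tensor_matrix_equiv e f _ (by simp)

lemma nonempty_algD_equiv (k : ℕ) :
    Nonempty (AlgD k ≃ₐ[ℝ] Matrix (Fin (2 ^ (k + 1))) (Fin (2 ^ (k + 1))) ℂ) := by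
  obtain ⟨e⟩ := nonempty_algA_equiv k
  exact nonempty_tensor_matrix_equiv e (AlgEquiv.refl : M2C ≃ₐ[ℝ] M2C) _ (by simp [pow_succ])

instance isSimpleRing_algA (k : ℕ) : IsSimpleRing (AlgA k) :=
  (nonempty_algA_equiv k).elim fun e => IsSimpleRing.of_ringEquiv e.symm.toRingEquiv inferInstance

instance isSimpleRing_algB (k : ℕ) : IsSimpleRing (AlgB k) :=
  (nonempty_algB_equiv k).elim fun e => IsSimpleRing.of_ringEquiv e.symm.toRingEquiv inferInstance

instance isSimpleRing_algC (k : ℕ) : IsSimpleRing (AlgC k) :=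
  (nonempty_algC_equiv k).elim fun e => IsSimpleRing.of_ringEquiv e.symm.toRingEquiv inferInstance

instance isSimpleRing_algD (k : ℕ) : IsSimpleRing (AlgD k) :=
  (nonempty_algD_equiv k).elim fun e => IsSimpleRing.of_ringEquiv e.symm.toRingEquiv inferInstance

end MatrixAlgebras

/-! ### The grading groups -/

section Groups

lemma nonempty_addEquiv_of_finrank_eq {V : Type*} [AddCommGroup V] [Module (ZMod 2) V]
    [Module.Finite (ZMod 2) V] {n : ℕ} (h : Module.finrank (ZMod 2) V = n) :
    Nonempty (V ≃+ (Fin n → ZMod 2)) :=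
  ⟨(LinearEquiv.ofFinrankEq V (Fin n → ZMod 2)
    (h.trans (Module.finrank_fin_fun _).symm)).toAddEquiv⟩

lemma finrank_grpA (k : ℕ) : Module.finrank (ZMod 2) (GrpA k) = 2 * k := by
  rw [Module.finrank_pi_fintype]
  simp [mul_comm]

lemma nonempty_grpA_equiv (k : ℕ) : Nonempty (GrpA k ≃+ (Fin (2 * k) → ZMod 2)) :=
  nonempty_addEquiv_of_finrank_eq (finrank_grpA k)

lemma nonempty_grpB_equiv (k : ℕ) : Nonempty (GrpB k ≃+ (Fin (2 * k + 2) → ZMod 2)) :=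
  nonempty_addEquiv_of_finrank_eq (by rw [Module.finrank_prod, finrank_grpA]; simp)

lemma nonempty_grpC_equiv (k : ℕ) : Nonempty (GrpC k ≃+ (Fin (2 * k + 1) → ZMod 2)) :=
  nonempty_addEquiv_of_finrank_eq (by rw [Module.finrank_prod, finrank_grpA]; simp)

lemma nonempty_grpD_equiv (k : ℕ) :
    Nonempty (GrpD k ≃+ (Fin (2 * k + 1) → ZMod 2) × ZMod 4) := by
  obtain ⟨e⟩ := nonempty_grpC_equiv k
  exact ⟨AddEquiv.prodAssoc.symm.trans (e.prodCongr (AddEquiv.refl _))⟩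

end Groups

/-! ### Graded bases of the four families -/

section Families

/-- The homogeneous basis of `M_2(ℝ)^{⊗k}` formed by the tensor products of the monomials in
`X_a`, `X_b`. -/
noncomputable def basisA (k : ℕ) (g : GrpA k) : AlgA k :=
  PiTensorProduct.tprod ℝ fun i => monomials 2 2 (!![-1, 0; 0, 1] : M2R) !![0, 1; 1, 0] (g i)

lemma isGradedBasis_basisA (k : ℕ) : IsGradedBasis (basisA k) := isGradedBasis_M2R.pow k

lemma gradingA_eq (k : ℕ) : gradingA k = fun g => Submodule.span ℝ {basisA k g} :=
  powGrading_span_singleton _ k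

lemma gradingB_eq (k : ℕ) : gradingB k = fun p => Submodule.span ℝ {basisA k p.1 ⊗ₜ[ℝ]
    monomials 2 2 (⟨0, 1, 0, 0⟩ : ℍ[ℝ]) ⟨0, 0, 1, 0⟩ p.2} := by
  rw [gradingB, gradingA_eq]
  exact tensorGrading_span_singleton _ _

lemma gradingC_eq (k : ℕ) : gradingC k = fun p => Submodule.span ℝ {basisA k p.1 ⊗ₜ[ℝ]
    (Complex.I ^ p.2.val)} := by
  rw [gradingC, gradingA_eq]
  exact tensorGrading_span_singleton _ _

lemma gradingD_eq (k : ℕ) : gradingD k = fun p => Submodule.span ℝ {basisA k p.1 ⊗ₜ[ℝ]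
    monomials 2 4 (!![0, 1; 1, 0] : M2C) !![1 + Complex.I, 0; 0, -1 - Complex.I] p.2} := by
  rw [gradingD, gradingA_eq]
  exact tensorGrading_span_singleton _ _

lemma isGradedBasis_B (k : ℕ) : IsGradedBasis (D := AlgB k) fun p : GrpB k =>
    basisA k p.1 ⊗ₜ[ℝ] monomials 2 2 (⟨0, 1, 0, 0⟩ : ℍ[ℝ]) ⟨0, 0, 1, 0⟩ p.2 :=
  (isGradedBasis_basisA k).tensor isGradedBasis_quaternion

lemma isGradedBasis_C (k : ℕ) : IsGradedBasis (D := AlgC k) fun p : GrpC k =>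
    basisA k p.1 ⊗ₜ[ℝ] (Complex.I ^ p.2.val) :=
  (isGradedBasis_basisA k).tensor isGradedBasis_complex

lemma isGradedBasis_D (k : ℕ) : IsGradedBasis (D := AlgD k) fun p : GrpD k =>
    basisA k p.1 ⊗ₜ[ℝ]
      monomials 2 4 (!![0, 1; 1, 0] : M2C) !![1 + Complex.I, 0; 0, -1 - Complex.I] p.2 :=
  (isGradedBasis_basisA k).tensor isGradedBasis_M2C

end Families

/-! ### Splitting off copies of `M_2(ℝ)` -/

section SignCommutative

/-- Multiplying `s` by a suitable monomial in the anticommuting elements `x`, `y` makes it commute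
with both. -/
lemma exists_mul_commute {R : Type*} [Ring R] {s x y : R} (h : y * x = -(x * y))
    (hx : x * s = s * x ∨ x * s = -(s * x)) (hy : y * s = s * y ∨ y * s = -(s * y)) :
    ∃ m, (m = 1 ∨ m = x ∨ m = y ∨ m = x * y) ∧ x * (s * m) = s * m * x ∧
      y * (s * m) = s * m * y := by
  rcases hx with hx | hx <;> rcases hy with hy | hy
  · exact ⟨1, by simp, by simpa using hx, by simpa using hy⟩
  · refine ⟨x, by simp, by rw [← mul_assoc, hx], ?_⟩
    rw [← mul_assoc, hy, neg_mul, mul_assoc, h, mul_neg, neg_neg, mul_assoc]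
  · refine ⟨y, by simp, ?_, by rw [← mul_assoc, hy]⟩
    rw [← mul_assoc, hx, mul_assoc s y x, h, mul_neg, neg_mul, mul_assoc]
  · refine ⟨x * y, by simp, ?_, ?_⟩
    · rw [← mul_assoc x s, hx, mul_assoc s (x * y) x, mul_assoc x y x, h, mul_neg, mul_neg, neg_mul,
        mul_assoc]
    · rw [← mul_assoc, hy, neg_mul, mul_assoc, ← mul_assoc y x y, h, neg_mul, mul_neg, neg_neg,
        mul_assoc, mul_assoc, mul_assoc]

variable {D : Type*} [Ring D] [Algebra ℝ D]

/-- A multiplicative set of units, stable under nonzero real scalars, any two elements of which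
commute or anticommute. The model is the set of nonzero homogeneous elements of a division
grading with one-dimensional components. -/
structure IsSignCommutative (S : Submonoid D) : Prop where
  isUnit : ∀ x ∈ S, IsUnit x
  smul_mem : ∀ (c : ℝ) (x : D), c ≠ 0 → x ∈ S → c • x ∈ S
  comm_or_anti : ∀ x ∈ S, ∀ y ∈ S, y * x = x * y ∨ y * x = -(x * y)

/-- `S` contains no two anticommuting elements with square `1`, which would generate a copy of
`M_2(ℝ)`. -/
def NoHyperbolicPair (S : Submonoid D) : Prop :=
  ∀ x ∈ S, ∀ y ∈ S, x * x = 1 → y * y = 1 → y * x ≠ -(x * y)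

lemma isAntiPair_two_one {x y : D} (hx : x * x = 1) (hy : y * y = 1) (h : y * x = -(x * y)) :
    IsAntiPair 2 2 1 1 x y where
  pow_left := by rw [pow_two, hx, one_smul]
  pow_right := by rw [pow_two, hy, one_smul]
  anti := h

lemma mem_of_mul_mem {B : Subalgebra ℝ D} {s x : D} {p : ℝ} (hp : p ≠ 0) (hx : x ∈ B)
    (hx4 : x ^ 4 = p • (1 : D)) (hs : s * x ∈ B) : s ∈ B := by
  have : s = p⁻¹ • (s * x * x ^ 3) := by
    rw [mul_assoc, ← pow_succ', hx4, mul_smul_comm, mul_one, inv_smul_smul₀ hp]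
  rw [this]
  exact B.smul_mem (B.mul_mem hs (B.pow_mem hx 3)) _

lemma mem_of_mul_monomial_mem {B : Subalgebra ℝ D} {s x y m : D} {p q : ℝ} (hp : p ≠ 0)
    (hq : q ≠ 0) (hx : x ∈ B) (hy : y ∈ B) (hx4 : x ^ 4 = p • (1 : D)) (hy4 : y ^ 4 = q • (1 : D))
    (hm : m = 1 ∨ m = x ∨ m = y ∨ m = x * y) (hs : s * m ∈ B) : s ∈ B := by
  rcases hm with rfl | rfl | rfl | rfl
  · simpa using hs
  · exact mem_of_mul_mem hp hx hx4 hs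
  · exact mem_of_mul_mem hq hy hy4 hs
  · rw [← mul_assoc] at hs
    exact mem_of_mul_mem hp hx hx4 (mem_of_mul_mem hq hy hy4 hs)

namespace IsSignCommutative

variable {S : Submonoid D}

lemma mono (hS : IsSignCommutative S) {T : Submonoid D} (h : T ≤ S)
    (hT : ∀ (c : ℝ) (x : D), c ≠ 0 → x ∈ T → c • x ∈ T) : IsSignCommutative T where
  isUnit x hx := hS.isUnit x (h hx)
  smul_mem := hT
  comm_or_anti x hx y hy := hS.comm_or_anti x (h hx) y (h hy)

lemma inf_centralizer (hS : IsSignCommutative S) (A : Set D) :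
    IsSignCommutative (S ⊓ Submonoid.centralizer A) :=
  hS.mono inf_le_left fun c x hc hx => ⟨hS.smul_mem c x hc hx.1, by
    rw [SetLike.mem_coe, Submonoid.mem_centralizer_iff]
    intro a ha
    rw [mul_smul_comm, smul_mul_assoc, Submonoid.mem_centralizer_iff.1 hx.2 a ha]⟩

lemma not_anti [Nontrivial D] (hS : IsSignCommutative S) {x y : D} (hx : x ∈ S) (hy : y ∈ S)
    (h : y * x = x * y) (h' : y * x = -(x * y)) : False := by
  have h0 : x * y ≠ 0 := (hS.isUnit _ (S.mul_mem hx hy)).ne_zero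
  rw [h] at h'
  have h2 : (2 : ℝ) • (x * y) = 0 := by
    rw [two_smul]
    nth_rewrite 1 [h']
    exact neg_add_cancel _
  exact (smul_ne_zero two_ne_zero h0) h2

lemma mul_self_comm (hS : IsSignCommutative S) {x y : D} (hx : x ∈ S) (hy : y ∈ S) :
    y * (x * x) = x * x * y := by
  rcases hS.comm_or_anti x hx y hy with h | h
  · rw [← mul_assoc, h, mul_assoc, h, mul_assoc]
  · rw [← mul_assoc, h, neg_mul, mul_assoc, h, mul_neg, neg_neg, mul_assoc]

end IsSignCommutative

lemma IsGradedBasis.commute {G A : Type*} [AddCommGroup G] [Ring A] [Algebra ℝ A] {X : G → A}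
    (hX : IsGradedBasis X) (f : A →ₐ[ℝ] D) {z : D} (h : ∀ g, Commute (f (X g)) z) (a : A) :
    Commute (f a) z := by
  have ha : a ∈ Submodule.span ℝ (Set.range X) := hX.span_eq_top ▸ Submodule.mem_top
  induction ha using Submodule.span_induction with
  | mem x hx => obtain ⟨g, rfl⟩ := hx; exact h g
  | zero => simp
  | add x y _ _ hx hy => rw [map_add]; exact hx.add_left hy
  | smul c x _ hx => rw [map_smul]; exact hx.smul_left c

/-- Splitting off all factors `M_2(ℝ)`: as long as `S` contains an anticommuting pair with squares
`1`, it is generated by this pair and the centralizer of the pair in `S`, whose span is smaller. The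
set `T` is what remains at the end. -/
lemma exists_algHom_algA [FiniteDimensional ℝ D] [Nontrivial D] (n : ℕ) :
    ∀ S : Submonoid D, IsSignCommutative S → Module.finrank ℝ (Submodule.span ℝ (S : Set D)) = n →
    ∃ (k : ℕ) (φ : AlgA k →ₐ[ℝ] D) (T : Submonoid D), T ≤ S ∧ IsSignCommutative T ∧
      (∀ g, φ (basisA k g) ∈ S) ∧ (∀ a, ∀ z ∈ T, Commute (φ a) z) ∧
      (∀ s ∈ S, s ∈ φ.range ⊔ Algebra.adjoin ℝ (T : Set D)) ∧ NoHyperbolicPair T ∧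
      ∀ z ∈ S, (∀ s ∈ S, s * z = z * s) → z ∈ T := by
  induction n using Nat.strong_induction_on with
  | _ n ih =>
  intro S hS hn
  by_cases hpair : NoHyperbolicPair S
  · obtain ⟨e⟩ := nonempty_powAlg_zero_equiv M2R
    refine ⟨0, (Algebra.ofId ℝ D).comp e.toAlgHom, S, le_rfl, hS, fun g => ?_, fun a z _ => ?_,
      fun s hs => ?_, hpair, fun z hz _ => hz⟩
    · have : basisA 0 g = 1 := by
        rw [Subsingleton.elim g 0, (isGradedBasis_basisA 0).apply_zero]
      rw [this, map_one]
      exact S.one_mem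
    · exact Algebra.commute_algebraMap_left _ _
    · exact (le_sup_right : _ ≤ AlgHom.range _ ⊔ _) (Algebra.subset_adjoin hs)
  unfold NoHyperbolicPair at hpair
  push Not at hpair
  obtain ⟨x, hx, y, hy, hxx, hyy, hxy⟩ := hpair
  set S' := S ⊓ Submonoid.centralizer {x, y} with hS'
  have hmem : ∀ z, z ∈ S' ↔ z ∈ S ∧ x * z = z * x ∧ y * z = z * y := by
    intro z
    rw [hS', Submonoid.mem_inf, Submonoid.mem_centralizer_iff]
    simp
  have hlt : Module.finrank ℝ (Submodule.span ℝ (S' : Set D)) < n := by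
    rw [← hn]
    refine Submodule.finrank_lt_finrank_of_lt (lt_of_le_of_ne
      (Submodule.span_mono inf_le_left) fun he => ?_)
    have hxS : x ∈ Submodule.span ℝ (S' : Set D) := he ▸ Submodule.subset_span hx
    have hle : Submodule.span ℝ (S' : Set D) ≤
        Subalgebra.toSubmodule (Subalgebra.centralizer ℝ {y}) := by
      refine Submodule.span_le.2 fun z hz => ?_
      rw [SetLike.mem_coe, Subalgebra.mem_toSubmodule, Subalgebra.mem_centralizer_iff]
      simpa using ((hmem z).1 hz).2.2
    have := (Subalgebra.mem_centralizer_iff ℝ).1 (hle hxS) y rfl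
    exact hS.not_anti hx hy this hxy
  obtain ⟨k, φ, T, hTS, hT, hφS, hφT, hgen, hnp, hcen⟩ :=
    ih _ hlt S' (hS.inf_centralizer _) rfl
  -- The pair `x`, `y` gives the new first tensor factor.
  have hpr := isAntiPair_two_one hxx hyy hxy
  obtain ⟨ψ, hψ⟩ := isAntiPair_M2R.exists_algHom isGradedBasis_M2R hpr
  have hψc : ∀ z, x * z = z * x → y * z = z * y → ∀ a, Commute (ψ a) z := by
    intro z h1 h2
    refine isGradedBasis_M2R.commute ψ fun g => ?_
    rw [hψ]
    exact (Commute.pow_left h1 _).mul_left (Commute.pow_left h2 _)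
  have hcomm : ∀ a b, Commute (ψ a) (φ b) := by
    intro a b
    refine ((isGradedBasis_basisA k).commute φ (fun g => ?_) b).symm
    have := (hmem _).1 (hφS g)
    exact (hψc _ this.2.1 this.2.2 a).symm
  set L := Algebra.TensorProduct.lift ψ φ hcomm with hL
  set Φ : AlgA (k + 1) →ₐ[ℝ] D := L.comp (consEquiv M2R k).toAlgHom with hΦ
  have hL' : ∀ a b, L (a ⊗ₜ b) = ψ a * φ b := fun a b => by
    rw [hL, Algebra.TensorProduct.lift_tmul]
  have hLr : ∀ t, L t ∈ Φ.range := fun t =>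
    ⟨(consEquiv M2R k).symm t, congrArg L ((consEquiv M2R k).apply_symm_apply t)⟩
  have hφr : φ.range ≤ Φ.range := by
    rintro _ ⟨a, rfl⟩
    have := hLr (1 ⊗ₜ a)
    rwa [hL', map_one, one_mul] at this
  have hψr : ψ.range ≤ Φ.range := by
    rintro _ ⟨a, rfl⟩
    have := hLr (a ⊗ₜ 1)
    rwa [hL', map_one, mul_one] at this
  have hxr : x ∈ Φ.range := hψr ⟨_, (hψ (1, 0)).trans (by simp [monomials, ZMod.val_one])⟩
  have hyr : y ∈ Φ.range := hψr ⟨_, (hψ (0, 1)).trans (by simp [monomials, ZMod.val_one])⟩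
  refine ⟨k + 1, Φ, T, hTS.trans inf_le_left, hT, fun g => ?_, fun a z hz => ?_, fun s hs => ?_,
    hnp, fun z hz hzc => hcen z ((hmem z).2 ⟨hz, hzc x hx, hzc y hy⟩)
      fun s hs => hzc s ((hmem s).1 hs).1⟩
  · have : Φ (basisA (k + 1) g) = ψ (monomials 2 2 !![-1, 0; 0, 1] !![0, 1; 1, 0] (g 0)) *
         φ (basisA k fun i => g i.succ) := by
      rw [← hL']
      exact congrArg L (consEquiv_tprod k _)
    rw [this, hψ]
    exact S.mul_mem (S.mul_mem (S.pow_mem hx _) (S.pow_mem hy _)) ((hmem _).1 (hφS _)).1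
  · have hz' := (hmem z).1 (hTS hz)
    suffices ∀ t, Commute (L t) z from this _
    intro t
    induction t using TensorProduct.induction_on with
    | zero => simp
    | tmul a b => rw [hL']; exact (hψc z hz'.2.1 hz'.2.2 a).mul_left (hφT b z hz)
    | add a b ha hb => rw [map_add]; exact ha.add_left hb
  · obtain ⟨m, hm, hmx, hmy⟩ := exists_mul_commute hxy (hS.comm_or_anti s hs x hx)
      (hS.comm_or_anti s hs y hy)
    have hmS : m ∈ S := by
      rcases hm with rfl | rfl | rfl | rfl
      exacts [S.one_mem, hx, hy, S.mul_mem hx hy]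
    have h4 : ∀ z : D, z * z = 1 → z ^ 4 = (1 : ℝ) • (1 : D) := fun z hz => by
      rw [show z ^ 4 = (z * z) * (z * z) by noncomm_ring, hz, one_smul, one_mul]
    exact mem_of_mul_monomial_mem one_ne_zero one_ne_zero
      ((le_sup_left : _ ≤ _ ⊔ Algebra.adjoin ℝ (T : Set D)) hxr)
      ((le_sup_left : _ ≤ _ ⊔ Algebra.adjoin ℝ (T : Set D)) hyr) (h4 x hxx) (h4 y hyy) hm
      (sup_le_sup_right hφr _ (hgen _ ((hmem _).2 ⟨S.mul_mem hs hmS, hmx, hmy⟩)))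

end SignCommutative

/-! ### Sets without hyperbolic pairs -/

section Anisotropic

lemma mul_mul_self_of_anti {R : Type*} [Ring R] {x y : R} (h : y * x = -(x * y)) :
    x * y * (x * y) = -(x * x * (y * y)) := by
  rw [mul_assoc, ← mul_assoc y x y, h, neg_mul, mul_neg, mul_assoc, mul_assoc]

lemma mul_mul_self_of_comm {R : Type*} [Ring R] {x y : R} (h : y * x = x * y) :
    x * y * (x * y) = x * x * (y * y) := by
  rw [mul_assoc, ← mul_assoc y x y, h, mul_assoc, mul_assoc]

variable {D : Type*} [Ring D] [Algebra ℝ D] {T : Submonoid D}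

namespace IsSignCommutative

/-- An element with nonzero real square can be scaled so that its square becomes `±1`. -/
lemma exists_normalize (hT : IsSignCommutative T) {x : D} (hx : x ∈ T) {c : ℝ} (hc : c ≠ 0)
    (h : x * x = c • (1 : D)) : ∃ r : ℝ, r ≠ 0 ∧ r • x ∈ T ∧
      (r • x) * (r • x) = (c / |c|) • (1 : D) := by
  have h0 : √|c| ≠ 0 := (Real.sqrt_pos.2 (abs_pos.2 hc)).ne'
  refine ⟨(√|c|)⁻¹, inv_ne_zero h0, hT.smul_mem _ _ (inv_ne_zero h0) hx, ?_⟩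
  rw [smul_mul_smul_comm, h, smul_smul, ← mul_inv, Real.mul_self_sqrt (abs_nonneg c),
    div_eq_inv_mul]

lemma false_of_pos (hT : IsSignCommutative T) (hnp : NoHyperbolicPair T) {x y : D} (hx : x ∈ T)
    (hy : y ∈ T) (h : y * x = -(x * y)) {c d : ℝ} (hc : 0 < c) (hd : 0 < d)
    (hxx : x * x = c • (1 : D)) (hyy : y * y = d • (1 : D)) : False := by
  obtain ⟨r, -, hr, hr'⟩ := hT.exists_normalize hx hc.ne' hxx
  obtain ⟨s, -, hs, hs'⟩ := hT.exists_normalize hy hd.ne' hyy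
  rw [abs_of_pos hc, div_self hc.ne', one_smul] at hr'
  rw [abs_of_pos hd, div_self hd.ne', one_smul] at hs'
  refine hnp _ hr _ hs hr' hs' ?_
  rw [smul_mul_smul_comm, smul_mul_smul_comm, h, smul_neg, mul_comm]

variable [Nontrivial D]

lemma ne_zero_of_eq_smul (hT : IsSignCommutative T) {x y : D} {c : ℝ} (hx : x ∈ T)
    (h : x = c • y) : c ≠ 0 := by
  rintro rfl
  rw [zero_smul] at h
  exact (hT.isUnit x hx).ne_zero h

/-- If all squares are real, every element of an anticommuting pair has negative square: otherwise
this element and the product of the two would form a hyperbolic pair. -/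
lemma neg_of_anti (hT : IsSignCommutative T) (hnp : NoHyperbolicPair T)
    (hsq : ∀ x ∈ T, ∃ c : ℝ, x * x = c • (1 : D)) {x y : D} (hx : x ∈ T) (hy : y ∈ T)
    (h : y * x = -(x * y)) : ∃ c : ℝ, c < 0 ∧ x * x = c • (1 : D) := by
  obtain ⟨c, hc⟩ := hsq x hx
  obtain ⟨d, hd⟩ := hsq y hy
  have hc0 : c ≠ 0 := hT.ne_zero_of_eq_smul (T.mul_mem hx hx) hc
  have hd0 : d ≠ 0 := hT.ne_zero_of_eq_smul (T.mul_mem hy hy) hd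
  refine ⟨c, lt_of_le_of_ne (not_lt.1 fun hpos => ?_) hc0, hc⟩
  rcases hd0.lt_or_gt with hneg | hpos'
  · refine hT.false_of_pos hnp hx (T.mul_mem hx hy) ?_ hpos
      (neg_pos.2 (mul_neg_of_pos_of_neg hpos hneg)) hc (?_ : _ = (-(c * d)) • (1 : D))
    · rw [mul_assoc, h, mul_neg]
    · rw [mul_mul_self_of_anti h, hc, hd, smul_mul_smul_comm, one_mul, neg_smul]
  · exact hT.false_of_pos hnp hx hy h hpos hpos' hc hd

/-- With real centre, a set `T` without hyperbolic pairs consists of real scalars or generates a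
quaternion algebra: an element `t` commuting with an anticommuting pair `x`, `y` but not central
would have negative square, and then `x * t`, `y * t` would form a hyperbolic pair. -/
lemma scalar_or_quaternion (hT : IsSignCommutative T) (hnp : NoHyperbolicPair T)
    (hcen : ∀ z ∈ T, (∀ s ∈ T, s * z = z * s) → ∃ c : ℝ, z = c • (1 : D)) :
    (∀ s ∈ T, ∃ c : ℝ, s = c • (1 : D)) ∨
      ∃ x ∈ T, ∃ y ∈ T, IsAntiPair 2 2 (-1) (-1) x y ∧
        ∀ s ∈ T, s ∈ Algebra.adjoin ℝ {x, y} := by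
  have hsq : ∀ x ∈ T, ∃ c : ℝ, x * x = c • (1 : D) := fun x hx =>
    hcen _ (T.mul_mem hx hx) fun s hs => hT.mul_self_comm hx hs
  by_cases hab : ∀ s ∈ T, ∀ t ∈ T, t * s = s * t
  · exact Or.inl fun s hs => hcen s hs fun t ht => hab s hs t ht
  push Not at hab
  obtain ⟨x₀, hx₀, y₀, hy₀, hne⟩ := hab
  have hxy₀ := (hT.comm_or_anti x₀ hx₀ y₀ hy₀).resolve_left hne
  have hyx₀ : x₀ * y₀ = -(y₀ * x₀) := by rw [hxy₀, neg_neg]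
  obtain ⟨c, hc, hxx₀⟩ := hT.neg_of_anti hnp hsq hx₀ hy₀ hxy₀
  obtain ⟨d, hd, hyy₀⟩ := hT.neg_of_anti hnp hsq hy₀ hx₀ hyx₀
  obtain ⟨r, -, hx, hxx⟩ := hT.exists_normalize hx₀ hc.ne hxx₀
  obtain ⟨r', -, hy, hyy⟩ := hT.exists_normalize hy₀ hd.ne hyy₀
  rw [abs_of_neg hc, div_neg, div_self hc.ne] at hxx
  rw [abs_of_neg hd, div_neg, div_self hd.ne] at hyy
  have hxy : r' • y₀ * r • x₀ = -(r • x₀ * r' • y₀) := by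
    rw [smul_mul_smul_comm, smul_mul_smul_comm, hxy₀, smul_neg, mul_comm]
  generalize r • x₀ = x at *
  generalize r' • y₀ = y at *
  refine Or.inr ⟨x, hx, y, hy, ⟨by rw [pow_two, hxx], by rw [pow_two, hyy], hxy⟩, fun s hs => ?_⟩
  obtain ⟨m, hm, hmx, hmy⟩ := exists_mul_commute hxy (hT.comm_or_anti s hs x hx)
    (hT.comm_or_anti s hs y hy)
  have hmT : m ∈ T := by
    rcases hm with rfl | rfl | rfl | rfl
    exacts [T.one_mem, hx, hy, T.mul_mem hx hy]
  have htT := T.mul_mem hs hmT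
  have h4 : ∀ z : D, z * z = (-1 : ℝ) • 1 → z ^ 4 = (1 : ℝ) • (1 : D) := fun z hz => by
    rw [show z ^ 4 = (z * z) * (z * z) by noncomm_ring, hz, smul_mul_smul_comm]
    norm_num
  refine mem_of_mul_monomial_mem one_ne_zero one_ne_zero (Algebra.subset_adjoin (by simp))
    (Algebra.subset_adjoin (by simp)) (h4 x hxx) (h4 y hyy) hm ?_
  generalize s * m = t at *
  suffices ht : ∀ u ∈ T, u * t = t * u by
    obtain ⟨e, rfl⟩ := hcen t htT ht
    exact Subalgebra.smul_mem _ (one_mem _) e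
  intro u hu
  by_contra hut
  obtain ⟨e, he, htt⟩ := hT.neg_of_anti hnp hsq htT hu
    ((hT.comm_or_anti t htT u hu).resolve_left hut)
  refine hT.false_of_pos hnp (T.mul_mem hx htT) (T.mul_mem hy htT) ?_ (neg_pos.2 he) (neg_pos.2 he)
    ?_ ?_
  · rw [mul_assoc, ← mul_assoc t, ← hmx, mul_assoc, ← mul_assoc, hxy, mul_assoc x t (y * t),
      ← mul_assoc t y t, ← hmy]
    noncomm_ring
  · rw [mul_mul_self_of_comm hmx.symm, hxx, htt, smul_mul_smul_comm, one_mul, neg_one_mul]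
  · rw [mul_mul_self_of_comm hmy.symm, hyy, htt, smul_mul_smul_comm, one_mul, neg_one_mul]

section ComplexCentre

variable {f : D}

/-- With a central square root `f` of `-1` at hand, two elements with real squares cannot
anticommute, since multiplication by `f` changes the sign of a square. -/
lemma false_of_real_sq (hT : IsSignCommutative T) (hnp : NoHyperbolicPair T) (hf : f ∈ T)
    (hff : f * f = (-1 : ℝ) • (1 : D)) (hfc : ∀ s ∈ T, s * f = f * s) {x y : D} (hx : x ∈ T)
    (hy : y ∈ T) (h : y * x = -(x * y)) {c d : ℝ} (hc : x * x = c • (1 : D))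
    (hd : y * y = d • (1 : D)) : False := by
  have key : ∀ z ∈ T, ∀ e : ℝ, z * z = e • (1 : D) → ∃ w, (w = 1 ∨ w = f) ∧ z * w ∈ T ∧
      ∃ e' : ℝ, 0 < e' ∧ z * w * (z * w) = e' • (1 : D) := by
    intro z hz e he
    have he0 : e ≠ 0 := hT.ne_zero_of_eq_smul (T.mul_mem hz hz) he
    rcases he0.lt_or_gt with hneg | hpos
    · refine ⟨f, Or.inr rfl, T.mul_mem hz hf, -e, neg_pos.2 hneg, ?_⟩
      rw [mul_mul_self_of_comm (hfc z hz).symm, he, hff, smul_mul_smul_comm, one_mul, mul_neg_one]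
    · exact ⟨1, Or.inl rfl, by simpa using hz, e, hpos, by simpa using he⟩
  have hcomm : ∀ w, (w = 1 ∨ w = f) → ∀ s ∈ T, w * s = s * w := by
    rintro w (rfl | rfl) s hs
    · simp
    · exact (hfc s hs).symm
  obtain ⟨v, hv, hxv, c', hc', hcc⟩ := key x hx c hc
  obtain ⟨w, hw, hyw, d', hd', hdd⟩ := key y hy d hd
  have hvT : v ∈ T := by rcases hv with rfl | rfl; exacts [T.one_mem, hf]
  refine hT.false_of_pos hnp hxv hyw ?_ hc' hd' hcc hdd
  rw [mul_assoc, ← mul_assoc w x v, hcomm w hw x hx, mul_assoc x w v, hcomm w hw v hvT, ← mul_assoc,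
    h, mul_assoc x v (y * w), ← mul_assoc v y w, hcomm v hv y hy]
  noncomm_ring

/-- With centre generated by `f`, `f ^ 2 = -1`, a set `T` without hyperbolic pairs either is central
or is generated by a pair `x`, `y` as in `M_2(ℂ)`. Namely, if the square of `y` is not real,
then any element commuting with `x` and `y` whose square is not real can be multiplied by `y` to
obtain one with a real square. -/
lemma central_or_quartic (hT : IsSignCommutative T) (hnp : NoHyperbolicPair T) (hf : f ∈ T)
    (hff : f * f = (-1 : ℝ) • (1 : D)) (hfc : ∀ s ∈ T, s * f = f * s)
    (hcen : ∀ z ∈ T, (∀ s ∈ T, s * z = z * s) →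
      (∃ c : ℝ, z = c • (1 : D)) ∨ ∃ c : ℝ, z = c • f) :
    (∀ s ∈ T, s ∈ Algebra.adjoin ℝ {f}) ∨
      ∃ x ∈ T, ∃ y ∈ T, IsAntiPair 2 4 1 (-4) x y ∧
        ∀ s ∈ T, s ∈ Algebra.adjoin ℝ {x, y} := by
  have hsq : ∀ x ∈ T, (∃ c : ℝ, x * x = c • (1 : D)) ∨ ∃ c : ℝ, x * x = c • f := fun x hx =>
    hcen _ (T.mul_mem hx hx) fun s hs => hT.mul_self_comm hx hs
  by_cases hab : ∀ s ∈ T, ∀ t ∈ T, t * s = s * t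
  · refine Or.inl fun s hs => ?_
    rcases hcen s hs fun t ht => hab s hs t ht with ⟨c, rfl⟩ | ⟨c, rfl⟩
    · exact Subalgebra.smul_mem _ (one_mem _) c
    · exact Subalgebra.smul_mem _ (Algebra.subset_adjoin (Set.mem_singleton f)) c
  push Not at hab
  obtain ⟨x₀, hx₀, y₀, hy₀, hne⟩ := hab
  have hxy₀ := (hT.comm_or_anti x₀ hx₀ y₀ hy₀).resolve_left hne
  have hyx₀ : x₀ * y₀ = -(y₀ * x₀) := by rw [hxy₀, neg_neg]
  have hmulf : ∀ a b : ℝ, (a • f) * (b • f) = (-(a * b)) • (1 : D) := fun a b => by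
    rw [smul_mul_smul_comm, hff, smul_smul, mul_neg_one]
  obtain ⟨a₀, ha₀, b₀, hb₀, hab₀, d, haa₀, c, hbb₀⟩ : ∃ a ∈ T, ∃ b ∈ T, b * a = -(a * b) ∧
      ∃ d : ℝ, a * a = d • (1 : D) ∧ ∃ c : ℝ, b * b = c • f := by
    rcases hsq y₀ hy₀ with ⟨d, hd⟩ | ⟨c, hc⟩
    · rcases hsq x₀ hx₀ with ⟨c, hc⟩ | ⟨c, hc⟩
      · exact (hT.false_of_real_sq hnp hf hff hfc hx₀ hy₀ hxy₀ hc hd).elim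
      · exact ⟨y₀, hy₀, x₀, hx₀, hyx₀, d, hd, c, hc⟩
    · rcases hsq x₀ hx₀ with ⟨d, hd⟩ | ⟨d, hd⟩
      · exact ⟨x₀, hx₀, y₀, hy₀, hxy₀, d, hd, c, hc⟩
      · refine ⟨x₀ * y₀, T.mul_mem hx₀ hy₀, y₀, hy₀, ?_, d * c, ?_, c, hc⟩
        · rw [← mul_assoc, hxy₀, neg_mul]
        · rw [mul_mul_self_of_anti hxy₀, hd, hc, hmulf, neg_smul, neg_neg]
  obtain ⟨a, ha, haa, haba⟩ : ∃ a ∈ T, a * a = 1 ∧ b₀ * a = -(a * b₀) := by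
    have hd0 : d ≠ 0 := hT.ne_zero_of_eq_smul (T.mul_mem ha₀ ha₀) haa₀
    obtain ⟨r, -, hr, hrr⟩ := hT.exists_normalize ha₀ hd0 haa₀
    have hra : b₀ * r • a₀ = -(r • a₀ * b₀) := by
      rw [mul_smul_comm, smul_mul_assoc, hab₀, smul_neg]
    rcases hd0.lt_or_gt with hneg | hpos
    · rw [abs_of_neg hneg, div_neg, div_self hd0] at hrr
      refine ⟨r • a₀ * f, T.mul_mem hr hf, ?_, ?_⟩
      · rw [mul_mul_self_of_comm (hfc _ hr).symm, hrr, hff, smul_mul_smul_comm]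
        norm_num
      · rw [← mul_assoc, hra, neg_mul, mul_assoc, hfc b₀ hb₀, ← mul_assoc]
    · rw [abs_of_pos hpos, div_self hd0, one_smul] at hrr
      exact ⟨_, hr, hrr, hra⟩
  have hc0 : c ≠ 0 := hT.ne_zero_of_eq_smul (T.mul_mem hb₀ hb₀) hbb₀
  -- The scaling factor `r` has `r ^ 2 = 2 / |c|`, so that `(r • b₀) ^ 4 = -(r ^ 4 * c ^ 2) = -4`.
  obtain ⟨r, hr0, hr⟩ : ∃ r : ℝ, r ≠ 0 ∧ r * r = 2 / |c| :=
    ⟨√(2 / |c|), by positivity, Real.mul_self_sqrt (by positivity)⟩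
  obtain ⟨b, hb, e, he, hbb, hee, hba⟩ : ∃ b ∈ T, ∃ e : ℝ, e ≠ 0 ∧ b * b = e • f ∧ e * e = 4 ∧
      b * a = -(a * b) := by
    refine ⟨r • b₀, hT.smul_mem _ _ hr0 hb₀, r * r * c, by positivity, ?_, ?_, ?_⟩
    · rw [smul_mul_smul_comm, hbb₀, smul_smul]
    · rw [hr]
      have : |c| ≠ 0 := abs_ne_zero.2 hc0
      field_simp
      rw [sq_abs]
      ring
    · rw [mul_smul_comm, smul_mul_assoc, haba, smul_neg]
  have ha4 : a ^ 4 = (1 : ℝ) • (1 : D) := by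
    rw [show a ^ 4 = (a * a) * (a * a) by noncomm_ring, haa, one_smul, one_mul]
  have hb4 : b ^ 4 = (-4 : ℝ) • (1 : D) := by
    rw [show b ^ 4 = (b * b) * (b * b) by noncomm_ring, hbb, hmulf, hee]
  refine Or.inr ⟨a, ha, b, hb, ⟨by rw [pow_two, haa, one_smul], hb4, hba⟩, fun s hs => ?_⟩
  have haA : a ∈ Algebra.adjoin ℝ {a, b} := Algebra.subset_adjoin (by simp)
  have hbA : b ∈ Algebra.adjoin ℝ {a, b} := Algebra.subset_adjoin (by simp)
  have hfA : f ∈ Algebra.adjoin ℝ {a, b} := by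
    rw [← inv_smul_smul₀ he f, ← hbb]
    exact Subalgebra.smul_mem _ (mul_mem hbA hbA) _
  obtain ⟨m, hm, hmx, hmy⟩ := exists_mul_commute hba (hT.comm_or_anti s hs a ha)
    (hT.comm_or_anti s hs b hb)
  have hmT : m ∈ T := by
    rcases hm with rfl | rfl | rfl | rfl
    exacts [T.one_mem, ha, hb, T.mul_mem ha hb]
  have htT := T.mul_mem hs hmT
  refine mem_of_mul_monomial_mem one_ne_zero (by norm_num) haA hbA ha4 hb4 hm ?_
  generalize s * m = t at *
  suffices ht : ∀ u ∈ T, u * t = t * u by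
    rcases hcen t htT ht with ⟨e, rfl⟩ | ⟨e, rfl⟩
    · exact Subalgebra.smul_mem _ (one_mem _) e
    · exact Subalgebra.smul_mem _ hfA e
  -- In the centralizer of `b`, an element with real square commutes with everything.
  have hQ : ∀ v ∈ T, b * v = v * b → (∃ c : ℝ, v * v = c • (1 : D)) → ∀ w ∈ T, b * w = w * b →
      w * v ≠ -(v * w) := by
    rintro v hv hvb ⟨c₁, hvv⟩ w hw hwb hvw
    rcases hsq w hw with ⟨c₂, hww⟩ | ⟨c₂, hww⟩
    · exact hT.false_of_real_sq hnp hf hff hfc hv hw hvw hvv hww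
    · have hwb2 : w * b * (w * b) = (-(c₂ * e)) • (1 : D) := by
        rw [mul_mul_self_of_comm hwb, hww, hbb, hmulf]
      refine hT.false_of_real_sq hnp hf hff hfc hv (T.mul_mem hw hb) ?_ hvv hwb2
      rw [mul_assoc, hvb, ← mul_assoc, hvw, neg_mul, mul_assoc]
  intro u₀ hu₀
  by_contra hut₀
  have hut₀ := (hT.comm_or_anti t htT u₀ hu₀).resolve_left hut₀
  obtain ⟨u, hu, hub, hut⟩ : ∃ u ∈ T, b * u = u * b ∧ u * t = -(t * u) := by
    rcases hT.comm_or_anti u₀ hu₀ b hb with h | h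
    · exact ⟨u₀, hu₀, h, hut₀⟩
    · refine ⟨u₀ * a, T.mul_mem hu₀ ha, ?_, ?_⟩
      · rw [← mul_assoc, h, neg_mul, mul_assoc, hba, mul_neg, neg_neg, mul_assoc]
      · rw [mul_assoc, hmx, ← mul_assoc, hut₀, neg_mul, mul_assoc]
  rcases hsq t htT with ht | ⟨c₁, ht⟩
  · exact hQ t htT hmy ht u hu hub hut
  rcases hsq u hu with hu' | ⟨c₂, hu'⟩
  · exact hQ u hu hub hu' t htT hmy (by rw [hut, neg_neg])
  refine hQ (t * u) (T.mul_mem htT hu) ?_ ⟨c₁ * c₂, ?_⟩ t htT hmy ?_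
  · rw [← mul_assoc, hmy, mul_assoc, hub, mul_assoc]
  · rw [mul_mul_self_of_anti hut, ht, hu', hmulf, neg_smul, neg_neg]
  · rw [mul_assoc, hut, mul_neg, neg_neg]

end ComplexCentre
end IsSignCommutative
end Anisotropic

/-! ### Homogeneous elements of a division grading -/

section HomogeneousUnits

/-- The centre of a finite-dimensional simple real algebra is `ℝ` or a copy of `ℂ`. -/
lemma nonempty_center_equiv (D : Type*) [Ring D] [Algebra ℝ D]
    [FiniteDimensional ℝ D] [IsSimpleRing D] :
    Nonempty (Subalgebra.center ℝ D ≃ₐ[ℝ] ℝ) ∨ Nonempty (Subalgebra.center ℝ D ≃ₐ[ℝ] ℂ) := by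
  have hF : IsField (Subalgebra.center ℝ D) := IsSimpleRing.isField_center D
  let _ := hF.toField
  exact Real.nonempty_algEquiv_or (Subalgebra.center ℝ D)

lemma HasDimOneComponents.exists_smul_eq {G D : Type*} [Ring D] [Algebra ℝ D]
    {𝒜 : G → Submodule ℝ D} (h1 : HasDimOneComponents 𝒜) {g : G} {x y : D}
    (hx : x ∈ 𝒜 g) (hx0 : x ≠ 0) (hy : y ∈ 𝒜 g) : ∃ c : ℝ, y = c • x := by
  have hg : g ∈ support 𝒜 := fun h => hx0 (by rwa [h, Submodule.mem_bot] at hx)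
  obtain ⟨c, hc⟩ := (finrank_eq_one_iff_of_nonzero' (⟨x, hx⟩ : 𝒜 g)
    (fun h => hx0 (congrArg Subtype.val h))).1 (h1 g hg) ⟨y, hy⟩
  exact ⟨c, (congrArg Subtype.val hc).symm⟩

variable {G D : Type*} [AddCommGroup G] [DecidableEq G] [Ring D] [Algebra ℝ D]
  {𝒜 : G → Submodule ℝ D}

namespace IsDivisionGrading

lemma mul_mem (hA : IsDivisionGrading 𝒜) {g h : G} {x y : D} (hx : x ∈ 𝒜 g) (hy : y ∈ 𝒜 h) :
    x * y ∈ 𝒜 (g + h) :=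
  hA.gradedMul.mul_mem hx hy

lemma pow_succ_mem (hA : IsDivisionGrading 𝒜) {g : G} {x : D} (hx : x ∈ 𝒜 g) (n : ℕ) :
    x ^ (n + 1) ∈ 𝒜 ((n + 1) • g) := by
  induction n with
  | zero => simpa using hx
  | succ n ih =>
    rw [pow_succ, succ_nsmul]
    exact hA.mul_mem ih hx

lemma finite_support [FiniteDimensional ℝ D] (hA : IsDivisionGrading 𝒜) :
    (support 𝒜).Finite :=
  WellFoundedGT.finite_ne_bot_of_iSupIndep hA.isInternal.submodule_iSupIndep

/-- A combination of two homogeneous elements that is homogeneous is a multiple of one of them. -/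
lemma eq_smul_or_eq_smul (hA : IsDivisionGrading 𝒜) (h1 : HasDimOneComponents 𝒜) {g h l : G}
    {x y z : D} (hx : x ∈ 𝒜 g) (hx0 : x ≠ 0) (hy : y ∈ 𝒜 h) (hy0 : y ≠ 0) (hz : z ∈ 𝒜 l)
    {a b : ℝ} (e : z = a • x + b • y) : (∃ c : ℝ, z = c • x) ∨ ∃ c : ℝ, z = c • y := by
  by_cases hg : g = l
  · subst hg; exact Or.inl (h1.exists_smul_eq hx hx0 hz)
  by_cases hh : h = l
  · subst hh; exact Or.inr (h1.exists_smul_eq hy hy0 hz)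
  have hz' : z ∈ ⨆ (j) (_ : j ≠ l), 𝒜 j := by
    rw [e]
    exact Submodule.add_mem _
      (Submodule.smul_mem _ _ ((le_iSup₂_of_le g hg le_rfl : 𝒜 g ≤ _) hx))
      (Submodule.smul_mem _ _ ((le_iSup₂_of_le h hh le_rfl : 𝒜 h ≤ _) hy))
  refine Or.inl ⟨0, ?_⟩
  rw [zero_smul]
  exact Submodule.disjoint_def.1 (hA.isInternal.submodule_iSupIndep l) z hz hz'

variable [Nontrivial D]

lemma pow_ne_zero (hA : IsDivisionGrading 𝒜) {g : G} {x : D} (hx : x ∈ 𝒜 g) (hx0 : x ≠ 0)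
    (n : ℕ) : x ^ n ≠ 0 :=
  ((hA.isUnit_of_mem g x hx hx0).pow n).ne_zero

variable [FiniteDimensional ℝ D]

/-- Degrees in the support have finite order, since the support is finite. -/
lemma exists_nsmul_eq_zero (hA : IsDivisionGrading 𝒜) {g : G} {x : D} (hx : x ∈ 𝒜 g)
    (hx0 : x ≠ 0) : ∃ n : ℕ, (n + 1) • g = 0 := by
  have := hA.finite_support.to_subtype
  let F : ℕ → support 𝒜 := fun n => ⟨(n + 1) • g, fun h => hA.pow_ne_zero hx hx0 (n + 1) (by
    have := hA.pow_succ_mem hx n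
    rwa [h, Submodule.mem_bot] at this)⟩
  obtain ⟨a, b, hab, h⟩ := Finite.exists_ne_map_eq_of_infinite F
  have h' : (a + 1) • g = (b + 1) • g := congrArg Subtype.val h
  wlog hlt : a < b generalizing a b
  · exact this b a hab.symm h.symm h'.symm (by omega)
  obtain ⟨k, rfl⟩ := Nat.exists_eq_add_of_lt hlt
  refine ⟨k, ?_⟩
  rw [show a + k + 1 + 1 = (a + 1) + (k + 1) by ring, add_nsmul g (a + 1) (k + 1)] at h'
  exact left_eq_add.1 h'

/-- Some power `u` of a homogeneous element has degree `0`; as `u ^ 2` is a multiple of `u`, the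
unit `u` is a real scalar. -/
lemma one_mem (hA : IsDivisionGrading 𝒜) (h1 : HasDimOneComponents 𝒜) : (1 : D) ∈ 𝒜 0 := by
  obtain ⟨g, hg⟩ : ∃ g, 𝒜 g ≠ ⊥ := by
    by_contra! h
    have := hA.isInternal.submodule_iSup_eq_top
    rw [iSup_eq_bot.2 h] at this
    exact bot_ne_top this
  obtain ⟨x, hx, hx0⟩ := (Submodule.ne_bot_iff _).1 hg
  obtain ⟨n, hn⟩ := hA.exists_nsmul_eq_zero hx hx0
  have hu := hA.pow_succ_mem hx n
  rw [hn] at hu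
  have hu0 := hA.pow_ne_zero hx hx0 (n + 1)
  generalize x ^ (n + 1) = u at *
  obtain ⟨c, hc⟩ := h1.exists_smul_eq hu hu0 (by simpa using hA.mul_mem hu hu)
  have huc : u = c • (1 : D) :=
    (hA.isUnit_of_mem 0 u hu hu0).mul_left_cancel (by rw [hc, mul_smul_comm, mul_one])
  have hc0 : c ≠ 0 := by rintro rfl; simp at huc; exact hu0 huc
  rw [← inv_smul_smul₀ hc0 (1 : D), ← huc]
  exact Submodule.smul_mem _ _ hu

/-- The nonzero homogeneous elements of a division grading. -/
def homogeneousUnits (hA : IsDivisionGrading 𝒜) (h1 : HasDimOneComponents 𝒜) : Submonoid D where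
  carrier := {x | x ≠ 0 ∧ ∃ g, x ∈ 𝒜 g}
  one_mem' := ⟨one_ne_zero, 0, hA.one_mem h1⟩
  mul_mem' := by
    rintro x y ⟨hx0, g, hx⟩ ⟨hy0, h, hy⟩
    exact ⟨((hA.isUnit_of_mem g x hx hx0).mul (hA.isUnit_of_mem h y hy hy0)).ne_zero, g + h,
      hA.mul_mem hx hy⟩

lemma span_homogeneousUnits (hA : IsDivisionGrading 𝒜) (h1 : HasDimOneComponents 𝒜) :
    Submodule.span ℝ (hA.homogeneousUnits h1 : Set D) = ⊤ := by
  rw [eq_top_iff, ← hA.isInternal.submodule_iSup_eq_top]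
  refine iSup_le fun g x hx => ?_
  by_cases hx0 : x = 0
  · rw [hx0]; exact Submodule.zero_mem _
  · exact Submodule.subset_span ⟨hx0, g, hx⟩

/-- Homogeneous elements commute up to a real factor, and this factor is `±1` because degrees in
the support have finite order. -/
lemma isSignCommutative (hA : IsDivisionGrading 𝒜) (h1 : HasDimOneComponents 𝒜) :
    IsSignCommutative (hA.homogeneousUnits h1) where
  isUnit := by
    rintro x ⟨hx0, g, hx⟩
    exact hA.isUnit_of_mem g x hx hx0
  smul_mem := by
    rintro c x hc ⟨hx0, g, hx⟩
    exact ⟨smul_ne_zero hc hx0, g, Submodule.smul_mem _ _ hx⟩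
  comm_or_anti := by
    rintro x ⟨hx0, g, hx⟩ y ⟨hy0, h, hy⟩
    have hxu := hA.isUnit_of_mem g x hx hx0
    have hyu := hA.isUnit_of_mem h y hy hy0
    obtain ⟨c, hc⟩ := h1.exists_smul_eq (hA.mul_mem hx hy) (hxu.mul hyu).ne_zero
      (by rw [add_comm]; exact hA.mul_mem hy hx : y * x ∈ 𝒜 (g + h))
    obtain ⟨n, hn⟩ := hA.exists_nsmul_eq_zero hx hx0
    have hxn := hA.pow_succ_mem hx n
    rw [hn] at hxn
    obtain ⟨d, hd⟩ := h1.exists_smul_eq (hA.one_mem h1) one_ne_zero hxn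
    have hd0 : d ≠ 0 := by
      rintro rfl
      rw [zero_smul] at hd
      exact hA.pow_ne_zero hx hx0 _ hd
    have hs : SemiconjBy y x (c • x) := by
      rw [SemiconjBy, smul_mul_assoc, hc]
    have hs' : d • y = (c ^ (n + 1) * d) • y := by
      have := (hs.pow_right (n + 1)).eq
      rwa [smul_pow, hd, mul_smul_comm, mul_one, smul_smul, smul_mul_assoc, one_mul] at this
    have hcn : c ^ (n + 1) = 1 := by
      have := smul_left_injective ℝ hy0 hs'
      exact mul_right_cancel₀ hd0 (by rw [one_mul]; exact this.symm)
    have habs : |c| = 1 := by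
      rw [← pow_eq_one_iff_of_nonneg (abs_nonneg c) n.succ_ne_zero, ← abs_pow, hcn, abs_one]
    rcases eq_or_eq_neg_of_abs_eq habs with rfl | rfl
    · left; rw [hc, one_smul]
    · right; rw [hc, neg_smul, one_smul]

lemma mem_center (hA : IsDivisionGrading 𝒜) (h1 : HasDimOneComponents 𝒜) {z : D}
    (hz : ∀ s ∈ hA.homogeneousUnits h1, s * z = z * s) : z ∈ Subalgebra.center ℝ D := by
  rw [Subalgebra.mem_center_iff]
  intro b
  have hb : b ∈ Submodule.span ℝ (hA.homogeneousUnits h1 : Set D) := by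
    rw [hA.span_homogeneousUnits h1]; exact Submodule.mem_top
  induction hb using Submodule.span_induction with
  | mem x hx => exact hz x hx
  | zero => simp
  | add x y _ _ hx hy => rw [add_mul, mul_add, hx, hy]
  | smul c x _ hx => rw [smul_mul_assoc, mul_smul_comm, hx]

/-- The central homogeneous elements: either they are all real, or they are the real multiples of
`1` and of a square root `f` of `-1`. -/
lemma central_homogeneous [IsSimpleRing D] (hA : IsDivisionGrading 𝒜)
    (h1 : HasDimOneComponents 𝒜) :
    (∀ z ∈ hA.homogeneousUnits h1, (∀ s ∈ hA.homogeneousUnits h1, s * z = z * s) →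
      ∃ c : ℝ, z = c • (1 : D)) ∨
    ∃ f ∈ hA.homogeneousUnits h1, f * f = (-1 : ℝ) • (1 : D) ∧
      (∀ s ∈ hA.homogeneousUnits h1, s * f = f * s) ∧
      ∀ z ∈ hA.homogeneousUnits h1, (∀ s ∈ hA.homogeneousUnits h1, s * z = z * s) →
        (∃ c : ℝ, z = c • (1 : D)) ∨ ∃ c : ℝ, z = c • f := by
  by_cases hsc : ∀ z ∈ hA.homogeneousUnits h1, (∀ s ∈ hA.homogeneousUnits h1, s * z = z * s) →
      ∃ c : ℝ, z = c • (1 : D)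
  · exact Or.inl hsc
  push Not at hsc
  obtain ⟨f, hf, hfc, hfn⟩ := hsc
  have hfu := (hA.isSignCommutative h1).isUnit f hf
  have hfC := hA.mem_center h1 hfc
  have hoi : ∀ (z : D) (hz : z ∈ Subalgebra.center ℝ D) (c : ℝ),
      (⟨z, hz⟩ : Subalgebra.center ℝ D) = c • 1 → z = c • (1 : D) :=
    fun z hz c h => congrArg Subtype.val h
  rcases nonempty_center_equiv D with he | he
  · obtain ⟨e⟩ := he
    refine (hfn (e ⟨f, hfC⟩) (hoi f hfC _ (e.injective ?_))).elim
    simp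
  obtain ⟨e⟩ := he
  set w := e ⟨f, hfC⟩ with hw
  have hwim : w.im ≠ 0 := by
    intro h0
    refine hfn w.re (hoi f hfC _ (e.injective ?_))
    apply Complex.ext <;> simp [← hw, h0]
  have hspan : ∀ z ∈ Subalgebra.center ℝ D, ∃ a b : ℝ, z = a • (1 : D) + b • f := by
    intro z hz
    set v := e ⟨z, hz⟩ with hv
    refine ⟨v.re - v.im / w.im * w.re, v.im / w.im, ?_⟩
    have : (⟨z, hz⟩ : Subalgebra.center ℝ D) =
        (v.re - v.im / w.im * w.re) • 1 + (v.im / w.im) • ⟨f, hfC⟩ := by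
      apply e.injective
      rw [map_add, map_smul, map_smul, map_one, ← hw, ← hv]
      apply Complex.ext <;> simp [hwim]
    exact congrArg Subtype.val this
  have hdich : ∀ z ∈ hA.homogeneousUnits h1, z ∈ Subalgebra.center ℝ D →
      (∃ c : ℝ, z = c • (1 : D)) ∨ ∃ c : ℝ, z = c • f := by
    rintro z ⟨-, l, hz⟩ hzC
    obtain ⟨a, b, hab⟩ := hspan z hzC
    obtain ⟨hf0, g, hfg⟩ := hf
    exact hA.eq_smul_or_eq_smul h1 (hA.one_mem h1) one_ne_zero hfg hf0 hz hab
  obtain ⟨c, hc⟩ : ∃ c : ℝ, f * f = c • (1 : D) := by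
    refine (hdich (f * f) (Submonoid.mul_mem _ hf hf)
      (Subalgebra.mul_mem _ hfC hfC)).resolve_right ?_
    rintro ⟨c, hc⟩
    exact hfn c (hfu.mul_left_cancel (by rw [hc, mul_smul_comm, mul_one]))
  have hcneg : c < 0 := by
    have h2 : w * w = (c : ℂ) := by
      have : (⟨f, hfC⟩ : Subalgebra.center ℝ D) * ⟨f, hfC⟩ = c • 1 := Subtype.ext hc
      have := congrArg e this
      rw [map_mul, map_smul, map_one, ← hw] at this
      rw [this]
      simp
    have him := congrArg Complex.im h2
    have hre := congrArg Complex.re h2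
    simp only [Complex.mul_re, Complex.mul_im, Complex.ofReal_re, Complex.ofReal_im] at him hre
    have hwre : w.re = 0 := by
      have : w.re * w.im = 0 := by linarith
      exact (mul_eq_zero.1 this).resolve_right hwim
    rw [hwre] at hre
    have : 0 < w.im * w.im := mul_self_pos.2 hwim
    linarith
  obtain ⟨r, hr0, hr, hrr⟩ := (hA.isSignCommutative h1).exists_normalize hf hcneg.ne hc
  rw [abs_of_neg hcneg, div_neg, div_self hcneg.ne] at hrr
  refine Or.inr ⟨r • f, hr, hrr, fun s hs => ?_, fun z hz hzc => ?_⟩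
  · rw [mul_smul_comm, smul_mul_assoc, hfc s hs]
  · refine (hdich z hz (hA.mem_center h1 hzc)).imp_right ?_
    rintro ⟨d, hd⟩
    exact ⟨d / r, by rw [smul_smul, div_mul_cancel₀ d hr0, hd]⟩

end IsDivisionGrading
end HomogeneousUnits

/-! ### Existence of an equivalent entry -/

section Transport

variable {G H D A E : Type*} [AddCommGroup G] [DecidableEq G] [Ring D] [Algebra ℝ D]
  [FiniteDimensional ℝ D] [AddCommGroup H] [DecidableEq H] [Nontrivial D] {𝒜 : G → Submodule ℝ D}
  [Ring A] [Algebra ℝ A] [Ring E] [Algebra ℝ E]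

/-- A homomorphism from a simple graded algebra that maps a graded basis to nonzero homogeneous
elements is an equivalence as soon as its range contains all homogeneous elements. -/
lemma gradedEquivalent_of_algHom (hA : IsDivisionGrading 𝒜) (h1 : HasDimOneComponents 𝒜)
    [IsSimpleRing A] {X : H → A} (hX : IsGradedBasis X) (Φ : A →ₐ[ℝ] D)
    (hΦ : ∀ h, Φ (X h) ∈ hA.homogeneousUnits h1)
    (hgen : ∀ s ∈ hA.homogeneousUnits h1, s ∈ Φ.range) :
    GradedEquivalent 𝒜 fun h => Submodule.span ℝ {X h} := by
  have hsurj : Function.Surjective Φ := by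
    have : (⊤ : Submodule ℝ D) ≤ Subalgebra.toSubmodule Φ.range := by
      rw [← hA.span_homogeneousUnits h1]
      exact Submodule.span_le.2 hgen
    exact fun d => this (Submodule.mem_top (x := d))
  have hinj : Function.Injective Φ := RingHom.injective (Φ : A →+* D)
  refine GradedEquivalent.symm hX.isDivisionGrading.toIsGrading hA.toIsGrading
    ⟨AlgEquiv.ofBijective Φ ⟨hinj, hsurj⟩, fun h _ => ?_⟩
  obtain ⟨h0, g, hg⟩ := hΦ h
  refine ⟨g, ?_⟩
  rw [Submodule.map_span, Set.image_singleton]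
  refine le_antisymm ((Submodule.span_singleton_le_iff_mem _ _).2 hg) fun y hy => ?_
  obtain ⟨c, rfl⟩ := h1.exists_smul_eq hg h0 hy
  exact Submodule.smul_mem _ _ (Submodule.mem_span_singleton_self _)

lemma gradedEquivalent_tensor {k : ℕ} (hA : IsDivisionGrading 𝒜) (h1 : HasDimOneComponents 𝒜)
    [IsSimpleRing (TensorAlg (AlgA k) E)] {Y : H → E} (hY : IsGradedBasis Y)
    (φ : AlgA k →ₐ[ℝ] D) (ψ : E →ₐ[ℝ] D) (hcomm : ∀ a b, Commute (φ a) (ψ b))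
    (hφ : ∀ g, φ (basisA k g) ∈ hA.homogeneousUnits h1)
    (hψ : ∀ h, ψ (Y h) ∈ hA.homogeneousUnits h1)
    (hgen : ∀ s ∈ hA.homogeneousUnits h1, s ∈ φ.range ⊔ ψ.range) :
    GradedEquivalent 𝒜 fun p : GrpA k × H => Submodule.span ℝ {basisA k p.1 ⊗ₜ[ℝ] Y p.2} := by
  refine gradedEquivalent_of_algHom hA h1 ((isGradedBasis_basisA k).tensor hY)
    (Algebra.TensorProduct.lift φ ψ hcomm) (fun p => ?_) fun s hs => ?_
  · rw [Algebra.TensorProduct.lift_tmul]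
    exact Submonoid.mul_mem _ (hφ _) (hψ _)
  · refine (sup_le ?_ ?_ : φ.range ⊔ ψ.range ≤ _) (hgen s hs)
    · rintro _ ⟨a, rfl⟩
      exact ⟨a ⊗ₜ 1, (Algebra.TensorProduct.lift_tmul _ _ _ _ _).trans (by simp)⟩
    · rintro _ ⟨b, rfl⟩
      exact ⟨1 ⊗ₜ b, (Algebra.TensorProduct.lift_tmul _ _ _ _ _).trans (by simp)⟩

end Transport

section Existence

variable {G D : Type*} [AddCommGroup G] [DecidableEq G] [Ring D] [Algebra ℝ D]
  [FiniteDimensional ℝ D] {𝒜 : G → Submodule ℝ D}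

/-- After all factors `M_2(ℝ)` are split off, the remaining homogeneous elements generate `ℝ`, `ℍ`,
`ℂ` or `M_2(ℂ)`, which gives the four families. -/
lemma exists_isEquivalentToEntry [IsSimpleRing D] (hA : IsDivisionGrading 𝒜)
    (h1 : HasDimOneComponents 𝒜) : ∃ e : ListEntry, IsEquivalentToEntry 𝒜 e := by
  have hS := hA.isSignCommutative h1
  obtain ⟨k, φ, T, hTS, hT, hφ, hφT, hgen, hnp, hcen⟩ := exists_algHom_algA _ _ hS rfl
  have hcenT : ∀ z ∈ T, (∀ s ∈ T, s * z = z * s) →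
      ∀ s ∈ hA.homogeneousUnits h1, s * z = z * s := by
    intro z hz hzT s hs
    have hle : φ.range ⊔ Algebra.adjoin ℝ (T : Set D) ≤ Subalgebra.centralizer ℝ {z} := by
      refine sup_le ?_ (Algebra.adjoin_le fun t ht => ?_)
      · rintro _ ⟨a, rfl⟩
        exact (Subalgebra.mem_centralizer_iff ℝ).2 fun y hy => by
          rw [Set.mem_singleton_iff.1 hy]
          exact (hφT a z hz).symm
      · exact (Subalgebra.mem_centralizer_iff ℝ).2 fun y hy => by
          rw [Set.mem_singleton_iff.1 hy]
          exact (hzT t ht).symm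
    exact ((Subalgebra.mem_centralizer_iff ℝ).1 (hle (hgen s hs)) z rfl).symm
  have hgen' : ∀ B : Subalgebra ℝ D, (∀ t ∈ T, t ∈ B) →
      ∀ s ∈ hA.homogeneousUnits h1, s ∈ φ.range ⊔ B := fun B hB s hs =>
    sup_le_sup_left (Algebra.adjoin_le hB) _ (hgen s hs)
  rcases hA.central_homogeneous h1 with hc | ⟨f, hf, hff, hfc, hc⟩
  · rcases hT.scalar_or_quaternion hnp fun z hz hzT => hc z (hTS hz) (hcenT z hz hzT) with
      hsc | ⟨x, hx, y, hy, hxy, hadj⟩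
    · refine ⟨.a k, ?_⟩
      change GradedEquivalent _ _
      rw [gradingA_eq]
      refine gradedEquivalent_of_algHom hA h1 (isGradedBasis_basisA k) φ hφ fun s hs => ?_
      have := hgen' ⊥ (fun t ht => ?_) s hs
      · rwa [sup_bot_eq] at this
      · obtain ⟨c, rfl⟩ := hsc t ht
        exact Subalgebra.smul_mem _ (one_mem _) c
    · obtain ⟨ψ, hψ⟩ := isAntiPair_quaternion.exists_algHom isGradedBasis_quaternion hxy
      refine ⟨.b k, ?_⟩
      change GradedEquivalent _ _
      rw [gradingB_eq]
      have hψT : ∀ g, ψ (monomials 2 2 ⟨0, 1, 0, 0⟩ ⟨0, 0, 1, 0⟩ g) ∈ T := fun g => by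
        rw [hψ]
        exact T.mul_mem (T.pow_mem hx _) (T.pow_mem hy _)
      refine gradedEquivalent_tensor (E := ℍ[ℝ]) hA h1 isGradedBasis_quaternion φ ψ
        (fun a b => (isGradedBasis_quaternion.commute ψ (fun g => (hφT a _ (hψT g)).symm) b).symm)
        hφ (fun g => hTS (hψT g)) (hgen' _ fun t ht => ?_)
      refine (Algebra.adjoin_le ?_ : _ ≤ ψ.range) (hadj t ht)
      rintro _ (rfl | rfl)
      · exact ⟨_, (hψ (1, 0)).trans (by simp [monomials, ZMod.val_one])⟩
      · exact ⟨_, (hψ (0, 1)).trans (by simp [monomials, ZMod.val_one])⟩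
  · have hfT : f ∈ T := hcen f hf hfc
    rcases hT.central_or_quartic hnp hfT hff (fun s hs => hfc s (hTS hs))
      (fun z hz hzT => hc z (hTS hz) (hcenT z hz hzT)) with hadj | ⟨x, hx, y, hy, hxy, hadj⟩
    · refine ⟨.c k, ?_⟩
      change GradedEquivalent _ _
      rw [gradingC_eq]
      rw [neg_one_smul] at hff
      set ψ : ℂ →ₐ[ℝ] D := Complex.liftAux f hff with hψ
      have hψI : ψ Complex.I = f := Complex.liftAux_apply_I f hff
      have hψT : ∀ g : ZMod 2, ψ (Complex.I ^ g.val) ∈ T := fun g => by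
        rw [map_pow, hψI]
        exact T.pow_mem hfT _
      refine gradedEquivalent_tensor (E := ℂ) (Y := fun g : ZMod 2 => Complex.I ^ g.val) hA h1
        isGradedBasis_complex φ ψ
        (fun a b => (isGradedBasis_complex.commute ψ (fun g => (hφT a _ (hψT g)).symm) b).symm)
        hφ (fun g => hTS (hψT g)) (hgen' _ fun t ht => ?_)
      refine (Algebra.adjoin_le ?_ : _ ≤ ψ.range) (hadj t ht)
      rintro _ rfl
      exact ⟨_, hψI⟩
    · obtain ⟨ψ, hψ⟩ := isAntiPair_M2C.exists_algHom isGradedBasis_M2C hxy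
      refine ⟨.d k, ?_⟩
      change GradedEquivalent _ _
      rw [gradingD_eq]
      have hψT : ∀ g, ψ (monomials 2 4 !![0, 1; 1, 0]
          !![1 + Complex.I, 0; 0, -1 - Complex.I] g) ∈ T := fun g => by
        rw [hψ]
        exact T.mul_mem (T.pow_mem hx _) (T.pow_mem hy _)
      refine gradedEquivalent_tensor (E := M2C) hA h1 isGradedBasis_M2C φ ψ
        (fun a b => (isGradedBasis_M2C.commute ψ (fun g => (hφT a _ (hψT g)).symm) b).symm)
        hφ (fun g => hTS (hψT g)) (hgen' _ fun t ht => ?_)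
      refine (Algebra.adjoin_le ?_ : _ ≤ ψ.range) (hadj t ht)
      have v1 : (1 : ZMod 4).val = 1 := rfl
      rintro _ (rfl | rfl)
      · exact ⟨_, (hψ (1, 0)).trans (by simp [monomials, ZMod.val_one])⟩
      · exact ⟨_, (hψ (0, 1)).trans (by simp [monomials, v1])⟩

end Existence

/-! ### Uniqueness of the entry -/

section Uniqueness

/-- For `N < 4 * n` the algebras `M_N(ℝ)` and `M_n(ℍ)` are not isomorphic: the right ideal of
`M_N(ℝ)` generated by a diagonal matrix unit has dimension at most `N`, whereas every nonzero right
ideal of `M_n(ℍ)` has dimension at least `4 * n`. -/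
lemma isEmpty_matrix_real_equiv_quaternion {N n : ℕ} (i : Fin N) (h : N < 4 * n) :
    IsEmpty (Matrix (Fin N) (Fin N) ℝ ≃ₐ[ℝ] Matrix (Fin n) (Fin n) ℍ[ℝ]) := by
  refine ⟨fun e => ?_⟩
  set p : Matrix (Fin N) (Fin N) ℝ := Matrix.single i i 1 with hp
  have hp0 : p ≠ 0 := fun h0 => by
    have := congrFun (congrFun h0 i) i
    simp [hp] at this
  have hle : Module.finrank ℝ (LinearMap.range (LinearMap.mulLeft ℝ p)) ≤ N := by
    let row : Matrix (Fin N) (Fin N) ℝ →ₗ[ℝ] (Fin N → ℝ) := LinearMap.proj i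
    have hinj : Function.Injective (row.domRestrict (LinearMap.range (LinearMap.mulLeft ℝ p))) := by
      rw [← LinearMap.ker_eq_bot, LinearMap.ker_eq_bot']
      rintro ⟨_, M, rfl⟩ hM
      have hM' : ∀ l, M i l = 0 := fun l => by
        have : (p * M) i l = 0 := congrFun hM l
        simpa [hp] using this
      refine Subtype.ext (Matrix.ext fun j l => ?_)
      change (p * M) j l = 0
      by_cases hj : j = i
      · subst hj; simpa [hp] using hM' l
      · exact Matrix.single_mul_apply_of_ne _ _ _ _ _ hj _
    simpa using LinearMap.finrank_le_finrank_of_injective hinj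
  have hge : 4 * n ≤ Module.finrank ℝ (LinearMap.range (LinearMap.mulLeft ℝ (e p))) := by
    obtain ⟨a, b, hab⟩ : ∃ a b, e p a b ≠ 0 := by
      by_contra! h0
      exact hp0 (e.injective (by rw [map_zero]; exact Matrix.ext h0))
    let F : (Fin n → ℍ[ℝ]) →ₗ[ℝ] LinearMap.range (LinearMap.mulLeft ℝ (e p)) :=
      { toFun := fun v => ⟨Matrix.of fun j l => e p j b * v l,
          Matrix.of fun j l => if j = b then v l else 0, by ext1 j l; simp [Matrix.mul_apply]⟩
        map_add' := fun v w => by ext1; ext1 j l; simp [mul_add]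
        map_smul' := fun c v => by ext1; ext1 j l; simp }
    have hF : Function.Injective F := by
      intro v w hvw
      ext1 l
      have : e p a b * v l = e p a b * w l :=
        congrFun (congrFun (congrArg Subtype.val hvw) a) l
      exact mul_left_cancel₀ hab this
    have := LinearMap.finrank_le_finrank_of_injective hF
    rwa [Module.finrank_pi_fintype, Finset.sum_const, Quaternion.finrank_eq_four, Finset.card_univ,
      Fintype.card_fin, smul_eq_mul, mul_comm] at this
  have heq : (LinearMap.range (LinearMap.mulLeft ℝ p)).map (e.toLinearEquiv : _ →ₗ[ℝ] _) =
      LinearMap.range (LinearMap.mulLeft ℝ (e p)) := by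
    ext x
    constructor
    · rintro ⟨_, ⟨M, rfl⟩, rfl⟩
      exact ⟨e M, (map_mul e p M).symm⟩
    · rintro ⟨M, rfl⟩
      exact ⟨_, ⟨e.symm M, rfl⟩, (map_mul e p _).trans (by simp)⟩
  have := LinearEquiv.finrank_map_eq e.toLinearEquiv (LinearMap.range (LinearMap.mulLeft ℝ p))
  rw [heq] at this
  omega

lemma not_gradedEquivalent_A_B (k : ℕ) : ¬ GradedEquivalent (gradingA (k + 1)) (gradingB k) := by
  rintro ⟨ψ, -⟩
  obtain ⟨e⟩ := nonempty_algA_equiv (k + 1)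
  obtain ⟨f⟩ := nonempty_algB_equiv k
  have hk : 0 < 2 ^ k := by positivity
  exact (isEmpty_matrix_real_equiv_quaternion ⟨0, by positivity⟩ (by rw [pow_succ]; omega)).false
    ((e.symm.trans ψ).trans f)

/-- In the family with last factor `ℂ` all homogeneous elements have real squares, whereas the
square of `1 ⊗ X_b` in the family with last factor `M_2(ℂ)` has nonzero degree. -/
lemma not_gradedEquivalent_D_C (k l : ℕ) : ¬ GradedEquivalent (gradingD k) (gradingC l) := by
  rintro ⟨ψ, hψ⟩
  have hD := isGradedBasis_D k
  have hC := isGradedBasis_C l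
  rw [gradingD_eq, gradingC_eq] at hψ
  rw [hD.support_eq_univ] at hψ
  obtain ⟨h, hh⟩ := hψ (0, (0, 1)) trivial
  obtain ⟨c, hc, hY⟩ := hD.mul_apply (0, (0, 1)) (0, (0, 1))
  have hmem := Submodule.mem_map_of_mem (f := ψ.toLinearMap)
    (Submodule.mem_span_singleton_self (R := ℝ) (basisA k (0 : GrpA k) ⊗ₜ[ℝ]
      monomials 2 4 (!![0, 1; 1, 0] : M2C) !![1 + Complex.I, 0; 0, -1 - Complex.I] (0, 1)))
  rw [hh] at hmem
  obtain ⟨d, hd⟩ := Submodule.mem_span_singleton.1 hmem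
  obtain ⟨d', -, hX⟩ := hC.mul_apply h h
  have h2 : h + h = 0 := by
    refine Prod.ext (funext fun i => Prod.ext ?_ ?_) ?_ <;> exact CharTwo.add_self_eq_zero _
  rw [h2, hC.apply_zero] at hX
  have hsq := congrArg (fun z => z * z) hd
  simp only [smul_mul_smul_comm, hX] at hsq
  change _ = ψ _ * ψ _ at hsq
  rw [← map_mul, hY, smul_smul, ← map_one ψ, ← map_smul, ← hD.apply_zero] at hsq
  have h0 := hD.eq_of_smul_eq_smul hc (ψ.injective hsq)
  have h3 : (0 : ZMod 4) = 1 + 1 := congrArg (fun g => g.2.2) h0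
  exact absurd h3 (by decide)

/-- The dimension of the algebra of an entry of the list. -/
def ListEntry.dim : ListEntry → ℕ
  | .a k => 4 ^ k
  | .b k => 4 ^ (k + 1)
  | .c k => 4 ^ k * 2
  | .d k => 4 ^ (k + 1) * 2

lemma finrank_eq_dim {G D : Type*} [Ring D] [Algebra ℝ D] {𝒜 : G → Submodule ℝ D} {e : ListEntry}
    (h : IsEquivalentToEntry 𝒜 e) : Module.finrank ℝ D = e.dim := by
  cases e with
  | a k =>
    obtain ⟨ψ, -⟩ := h
    rw [ψ.toLinearEquiv.finrank_eq, Module.finrank_eq_card_basis (isGradedBasis_basisA k).basis]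
    simp [ListEntry.dim]
  | b k =>
    obtain ⟨ψ, -⟩ := h
    rw [ψ.toLinearEquiv.finrank_eq, Module.finrank_eq_card_basis (isGradedBasis_B k).basis]
    simp [ListEntry.dim, pow_succ]
  | c k =>
    obtain ⟨ψ, -⟩ := h
    rw [ψ.toLinearEquiv.finrank_eq, Module.finrank_eq_card_basis (isGradedBasis_C k).basis]
    simp [ListEntry.dim, ZMod.card]
  | d k =>
    obtain ⟨ψ, -⟩ := h
    rw [ψ.toLinearEquiv.finrank_eq, Module.finrank_eq_card_basis (isGradedBasis_D k).basis]
    simp [ListEntry.dim, ZMod.card, pow_succ, mul_assoc]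

lemma four_pow_ne_four_pow_mul_two (k l : ℕ) : 4 ^ k ≠ 4 ^ l * 2 := by
  intro h
  rw [show 4 = 2 ^ 2 by norm_num, ← pow_mul, ← pow_mul, ← pow_succ] at h
  have := Nat.pow_right_injective le_rfl h
  omega

/-- Dimensions leave only two possible coincidences in the list, `M_2(ℝ)^{⊗(k+1)}` with
`M_2(ℝ)^{⊗k} ⊗ ℍ` and `M_2(ℝ)^{⊗(k+1)} ⊗ ℂ` with `M_2(ℝ)^{⊗k} ⊗ M_2(ℂ)`; the first is excluded by
the underlying algebras, the second by the squares of homogeneous elements. -/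
lemma entry_unique {G D : Type*} [AddCommGroup G] [DecidableEq G] [Ring D] [Algebra ℝ D]
    {𝒜 : G → Submodule ℝ D} (hA : IsGrading 𝒜) {e e' : ListEntry}
    (h : IsEquivalentToEntry 𝒜 e) (h' : IsEquivalentToEntry 𝒜 e') : e = e' := by
  have hdim := (finrank_eq_dim h).symm.trans (finrank_eq_dim h')
  have hpow : ∀ {m n : ℕ}, 4 ^ m = 4 ^ n → m = n := fun h =>
    Nat.pow_right_injective (by norm_num) h
  have hpow2 : ∀ {m n : ℕ}, 4 ^ m * 2 = 4 ^ n * 2 → m = n := fun h => hpow (by omega)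
  have hAB : ∀ k l, 4 ^ k = 4 ^ (l + 1) → GradedEquivalent 𝒜 (gradingA k) →
      GradedEquivalent 𝒜 (gradingB l) → False := by
    intro k l hkl h₁ h₂
    obtain rfl := hpow hkl
    refine not_gradedEquivalent_A_B l (GradedEquivalent.trans (h₁.symm hA ?_) h₂)
    rw [gradingA_eq]
    exact (isGradedBasis_basisA _).isDivisionGrading.toIsGrading
  have hDC : ∀ k l, GradedEquivalent 𝒜 (gradingD k) → GradedEquivalent 𝒜 (gradingC l) → False := by
    intro k l h₁ h₂
    refine not_gradedEquivalent_D_C k l (GradedEquivalent.trans (h₁.symm hA ?_) h₂)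
    rw [gradingD_eq]
    exact (isGradedBasis_D _).isDivisionGrading.toIsGrading
  cases e with
  | a k =>
    cases e' with
    | a l => rw [hpow hdim]
    | b l => exact (hAB k l hdim h h').elim
    | c l => exact (four_pow_ne_four_pow_mul_two _ _ hdim).elim
    | d l => exact (four_pow_ne_four_pow_mul_two _ _ hdim).elim
  | b k =>
    cases e' with
    | a l => exact (hAB l k hdim.symm h' h).elim
    | b l => rw [Nat.succ_injective (hpow hdim)]
    | c l => exact (four_pow_ne_four_pow_mul_two _ _ hdim).elim
    | d l => exact (four_pow_ne_four_pow_mul_two _ _ hdim).elim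
  | c k =>
    cases e' with
    | a l => exact (four_pow_ne_four_pow_mul_two _ _ hdim.symm).elim
    | b l => exact (four_pow_ne_four_pow_mul_two _ _ hdim.symm).elim
    | c l => rw [hpow2 hdim]
    | d l => exact (hDC l k h' h).elim
  | d k =>
    cases e' with
    | a l => exact (four_pow_ne_four_pow_mul_two _ _ hdim.symm).elim
    | b l => exact (four_pow_ne_four_pow_mul_two _ _ hdim.symm).elim
    | c l => exact (hDC k l h h').elim
    | d l => rw [Nat.succ_injective (hpow2 hdim)]

end Uniqueness
end DivGrading

open DivGrading in
theorem mainTheorem1 :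
    -- (1-a)
    (∀ k : ℕ, IsDivisionGrading (gradingA k) ∧ HasDimOneComponents (gradingA k) ∧
      support (gradingA k) = Set.univ ∧
      Nonempty (AlgA k ≃ₐ[ℝ] Matrix (Fin (2 ^ k)) (Fin (2 ^ k)) ℝ) ∧
      Nonempty (GrpA k ≃+ (Fin (2 * k) → ZMod 2))) ∧
    -- (1-b)
    (∀ k : ℕ, IsDivisionGrading (gradingB k) ∧ HasDimOneComponents (gradingB k) ∧
      support (gradingB k) = Set.univ ∧
      Nonempty (AlgB k ≃ₐ[ℝ] Matrix (Fin (2 ^ k)) (Fin (2 ^ k)) ℍ[ℝ]) ∧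
      Nonempty (GrpB k ≃+ (Fin (2 * k + 2) → ZMod 2))) ∧
    -- (1-c)
    (∀ k : ℕ, IsDivisionGrading (gradingC k) ∧ HasDimOneComponents (gradingC k) ∧
      support (gradingC k) = Set.univ ∧
      Nonempty (AlgC k ≃ₐ[ℝ] Matrix (Fin (2 ^ k)) (Fin (2 ^ k)) ℂ) ∧
      Nonempty (GrpC k ≃+ (Fin (2 * k + 1) → ZMod 2))) ∧
    -- (1-d)
    (∀ k : ℕ, IsDivisionGrading (gradingD k) ∧ HasDimOneComponents (gradingD k) ∧
      support (gradingD k) = Set.univ ∧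
      Nonempty (AlgD k ≃ₐ[ℝ] Matrix (Fin (2 ^ (k + 1))) (Fin (2 ^ (k + 1))) ℂ) ∧
      Nonempty (GrpD k ≃+ (Fin (2 * k + 1) → ZMod 2) × ZMod 4)) ∧
    -- the classification up to equivalence
    (∀ (G : Type*) [AddCommGroup G] [DecidableEq G]
      (D : Type*) [Ring D] [Algebra ℝ D] [FiniteDimensional ℝ D] [IsSimpleRing D]
      (𝒜 : G → Submodule ℝ D), IsDivisionGrading 𝒜 → HasDimOneComponents 𝒜 →
        ∃! e : ListEntry, IsEquivalentToEntry 𝒜 e) := by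
  refine ⟨fun k => ?_, fun k => ?_, fun k => ?_, fun k => ?_, ?_⟩
  · rw [gradingA_eq]
    have h := isGradedBasis_basisA k
    exact ⟨h.isDivisionGrading, h.hasDimOneComponents, h.support_eq_univ, nonempty_algA_equiv k,
      nonempty_grpA_equiv k⟩
  · rw [gradingB_eq]
    have h := isGradedBasis_B k
    exact ⟨h.isDivisionGrading, h.hasDimOneComponents, h.support_eq_univ, nonempty_algB_equiv k,
      nonempty_grpB_equiv k⟩
  · rw [gradingC_eq]
    have h := isGradedBasis_C k
    exact ⟨h.isDivisionGrading, h.hasDimOneComponents, h.support_eq_univ, nonempty_algC_equiv k,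
      nonempty_grpC_equiv k⟩
  · rw [gradingD_eq]
    have h := isGradedBasis_D k
    exact ⟨h.isDivisionGrading, h.hasDimOneComponents, h.support_eq_univ, nonempty_algD_equiv k,
      nonempty_grpD_equiv k⟩
  · intro G _ _ D _ _ _ _ 𝒜 hA h1
    obtain ⟨e, he⟩ := exists_isEquivalentToEntry hA h1
    exact ⟨e, he, fun e' he' => entry_unique hA.toIsGrading he' he⟩
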